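/- All point sets are finite subsets of the plane with no three points collinear. A \emph{triangulation} of a point set $S\subset\mathbb{R}^2$ is a plane straight-line graph with vertex set $S$ such that all bounded faces are triangles that jointly tile the convex hull of $S$. For a triangulation $T$, let $C(T)$ denote the number of convex polygons in $T$, that is, the number of cycles of $T$ that bound a convex polygon (which may contain further vertices and edges of $T$ in its interior). For an integer $n\ge 3$, let $C(n)$ be the maximum of $C(T)$ over all triangulations $T$ of $n$ points in the plane, and let $C_{\mathsf{x}}(n)$ be the maximum of $C(T)$ over all triangulations $T$ of $n$ points in convex position. Then, for every $n\ge 3$, both maxima exist and $$C(n)\le (2n-5)\,C_{\mathsf{x}}(n).$$ -/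

import Mathlib

/-- The Euclidean plane. -/
abbrev Plane : Type := EuclideanSpace ℝ (Fin 2)

/-- No three (distinct) points of `S` lie on a common line. -/
def NoThreeCollinear (S : Finset Plane) : Prop :=
  ∀ a ∈ S, ∀ b ∈ S, ∀ c ∈ S, a ≠ b → a ≠ c → b ≠ c → ¬ Collinear ℝ ({a, b, c} : Set Plane)

/-- The points of `A` are in convex position: none of them lies in the convex hull of the others. -/
def InConvexPosition (A : Finset Plane) : Prop :=
  ConvexIndependent ℝ (fun p : A => (p : Plane))

/-- `G` is a plane straight-line graph with vertex set `S`: its edges, drawn as segments, have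
their endpoints in `S`, pass through no other point of `S`, and two distinct edges meet only in
common endpoints. -/
structure IsPlaneStraightLineGraph (S : Finset Plane) (G : SimpleGraph Plane) : Prop where
  endpoint_mem : ∀ p q, G.Adj p q → p ∈ S ∧ q ∈ S
  vertex_on_edge : ∀ p q, G.Adj p q → ∀ v ∈ S, v ∈ segment ℝ p q → v = p ∨ v = q
  noncrossing : ∀ p q r s, G.Adj p q → G.Adj r s → s(p, q) ≠ s(r, s) →
    segment ℝ p q ∩ segment ℝ r s ⊆ ({p, q} : Set Plane) ∩ {r, s}

/-- The point set covered by the vertices and the edges of the graph. -/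
def drawing (S : Finset Plane) (G : SimpleGraph Plane) : Set Plane :=
  (S : Set Plane) ∪ {x | ∃ p q, G.Adj p q ∧ x ∈ segment ℝ p q}

/-- The bounded faces: the bounded connected components of the complement of the drawing. -/
def boundedFaces (S : Finset Plane) (G : SimpleGraph Plane) : Set (Set Plane) :=
  {F | Bornology.IsBounded F ∧
    ∃ x ∈ (drawing S G)ᶜ, F = connectedComponentIn (drawing S G)ᶜ x}

/-- `G` is a (geometric) triangulation of the point set `S`, no three points of which are
collinear: a plane straight-line graph with vertex set `S` such that all bounded faces are
triangles (bounded by three edges of `G`) that jointly tile the convex hull of `S`. Distinct faces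
are disjoint by definition, so that tiling amounts to covering by the closed faces. -/
structure IsTriangulation (S : Finset Plane) (G : SimpleGraph Plane) : Prop where
  noThreeCollinear : NoThreeCollinear S
  plane : IsPlaneStraightLineGraph S G
  face_triangle : ∀ F ∈ boundedFaces S G, ∃ a b c, G.Adj a b ∧ G.Adj b c ∧ G.Adj c a ∧
    F = interior (convexHull ℝ ({a, b, c} : Set Plane))
  tile : ⋃ F ∈ boundedFaces S G, closure F = convexHull ℝ (S : Set Plane)

/-- The boundary cycle of the convex polygon with vertex set `A`, as a graph: two vertices are
adjacent when the segment between them is contained in the boundary of the convex hull of `A`. -/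
def boundaryCycle (A : Finset Plane) : SimpleGraph Plane where
  Adj a b := a ≠ b ∧ a ∈ A ∧ b ∈ A ∧ segment ℝ a b ⊆ frontier (convexHull ℝ (A : Set Plane))
  symm := ⟨fun a b h => ⟨h.1.symm, h.2.2.1, h.2.1, segment_symm ℝ a b ▸ h.2.2.2⟩⟩
  loopless := ⟨fun _ h => h.1 rfl⟩

open Classical in
/-- The convex polygons in `G`, given by their vertex sets: at least three vertices from `S`, in
convex position, such that the boundary cycle of the polygon is a subgraph of `G`. (A convex
polygon is determined by its vertex set.) -/
noncomputable def convexPolygons (S : Finset Plane) (G : SimpleGraph Plane) :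
    Finset (Finset Plane) :=
  {A ∈ S.powerset | 3 ≤ A.card ∧ InConvexPosition A ∧ boundaryCycle A ≤ G}

/-- The numbers of convex polygons that occur in triangulations of `n` points in the plane. -/
def polygonCounts (n : ℕ) : Set ℕ :=
  {m | ∃ (S : Finset Plane) (G : SimpleGraph Plane),
    S.card = n ∧ IsTriangulation S G ∧ m = (convexPolygons S G).card}

/-- The numbers of convex polygons that occur in triangulations of `n` points in convex
position. -/
def convexPolygonCounts (n : ℕ) : Set ℕ :=
  {m | ∃ (S : Finset Plane) (G : SimpleGraph Plane),
    S.card = n ∧ InConvexPosition S ∧ IsTriangulation S G ∧ m = (convexPolygons S G).card}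

/-- `C(n)`: the maximum number of convex polygons in a triangulation of `n` points. -/
noncomputable def maxConvexPolygons (n : ℕ) : ℕ := sSup (polygonCounts n)

/-- The maximum number of convex polygons in a triangulation of `n` points in convex position. -/
noncomputable def maxConvexPolygonsConvexPosition (n : ℕ) : ℕ := sSup (convexPolygonCounts n)

/-! Two counting steps multiply: few points meet every convex polygon, and few convex polygons
surround one point.

For the factor `2 * n - 5`, take a linear functional injective on `S`. Every convex polygon has a
vertex `b` that is neither its lowest nor its highest, and the level line through `b` enters the
interior on one of its two sides. All polygons with the same `b` and the same side share an interior
point near `b`. The lowest and the highest point of `S` never serve as `b`, which leaves `2 * (n -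
2)` classes. If the two lowest points span a hull edge (`exists_sweep_functional`), one side of the
second lowest point is never needed, and one class disappears (`card_convexPolygons_le`).

For the other factor, fix a generic point `o` and order `S` by angle around `o`. Replace a polygon
`A` around `o` by all points of `S` in its hull and send them, by angular rank, to points of a
parabola. Edges of the image correspond to angular gaps between consecutive points of `S` in the
hull. Gaps of two polygons never cross: otherwise the boundaries of the two hulls would exchange
their radial order within a common range of directions, and two edges of the plane graph would cross
(`not_crossing_gaps`). Hence all gaps together form a noncrossing family of chords, which extends to
a triangulation of the parabola points (`IsMaximalNoncrossing.isTriangulation`) containing all image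
polygons. The set of points in the hull determines the hull and hence `A`, so the map is injective
(`exists_card_polygonsAround_le`). -/

/-! ### Orientation, triangles and collinearity. -/

/-- Twice the signed area of the triangle `a b c`. -/
def orient (a b c : Plane) : ℝ := (b 0 - a 0) * (c 1 - a 1) - (b 1 - a 1) * (c 0 - a 0)

theorem convexHull_affine_nonneg {A : Set Plane} {α β γ : ℝ}
    (h : ∀ a ∈ A, 0 ≤ α * a 0 + β * a 1 + γ) {x : Plane} (hx : x ∈ convexHull ℝ A) :
    0 ≤ α * x 0 + β * x 1 + γ := by
  have hc : Convex ℝ {x : Plane | 0 ≤ α * x 0 + β * x 1 + γ} := by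
    intro x hx y hy a b ha hb hab
    simp only [Set.mem_ofPred_eq, PiLp.add_apply, PiLp.smul_apply, smul_eq_mul] at *
    have h1 := mul_nonneg ha hx
    have h2 := mul_nonneg hb hy
    have : γ = a * γ + b * γ := by rw [← add_mul, hab, one_mul]
    linarith
  exact convexHull_min (fun a ha => h a ha) hc hx

/-- An interior point can move a little against the gradient without leaving `K`; this strictly
lowers the form, which stays nonnegative. -/
theorem affine_pos_of_mem_interior {K : Set Plane} {α β γ : ℝ} (hne : α ≠ 0 ∨ β ≠ 0)
    (h : ∀ a ∈ K, 0 ≤ α * a 0 + β * a 1 + γ) {x : Plane} (hx : x ∈ interior K) :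
    0 < α * x 0 + β * x 1 + γ := by
  have hpos : 0 < α ^ 2 + β ^ 2 := by
    rcases hne with h | h
    · have := sq_pos_of_ne_zero h
      have := sq_nonneg β
      linarith
    · have := sq_pos_of_ne_zero h
      have := sq_nonneg α
      linarith
  have hcont : Continuous fun t : ℝ => x + t • (!₂[-α, -β] : Plane) := by fun_prop
  have hev : ∀ᶠ t in nhds (0 : ℝ), x + t • (!₂[-α, -β] : Plane) ∈ interior K := by
    apply hcont.continuousAt.eventually_mem
    exact isOpen_interior.mem_nhds (by simpa using hx)
  obtain ⟨t, ht, ht0⟩ := ((hev.filter_mono nhdsWithin_le_nhds).and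
    (self_mem_nhdsWithin : Set.Ioi (0 : ℝ) ∈ nhdsWithin 0 (Set.Ioi 0))).exists
  have h1 := h _ (interior_subset ht)
  simp at h1 ht0
  nlinarith [mul_pos ht0 hpos]

theorem isOpen_affine_pos (α β γ : ℝ) : IsOpen {x : Plane | 0 < α * x 0 + β * x 1 + γ} :=
  isOpen_lt continuous_const (by fun_prop)

theorem orient_eq_affine (a b x : Plane) :
    orient a b x = (a 1 - b 1) * x 0 + (b 0 - a 0) * x 1 + (a 0 * b 1 - a 1 * b 0) := by
  unfold orient; ring

theorem orient_rotate (a b c : Plane) : orient b c a = orient a b c := by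
  unfold orient; ring

theorem orient_swap (a b c : Plane) : orient b a c = - orient a b c := by
  unfold orient; ring

theorem convexHull_orient_nonneg {A : Set Plane} {p q : Plane} (h : ∀ a ∈ A, 0 ≤ orient p q a)
    {x : Plane} (hx : x ∈ convexHull ℝ A) : 0 ≤ orient p q x := by
  simp only [orient_eq_affine] at *
  exact convexHull_affine_nonneg h hx

theorem isOpen_orient_pos (a b : Plane) : IsOpen {x : Plane | 0 < orient a b x} := by
  simp only [orient_eq_affine]
  exact isOpen_affine_pos _ _ _

theorem ne_coord {a b : Plane} (h : a ≠ b) : a 0 ≠ b 0 ∨ a 1 ≠ b 1 := by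
  by_contra! hc
  apply h
  ext i
  fin_cases i
  · exact hc.1
  · exact hc.2

theorem orient_pos_of_mem_interior {K : Set Plane} {p q : Plane} (hne : p ≠ q)
    (h : ∀ a ∈ K, 0 ≤ orient p q a) {x : Plane} (hx : x ∈ interior K) : 0 < orient p q x := by
  simp only [orient_eq_affine] at *
  refine affine_pos_of_mem_interior ?_ h hx
  rcases ne_coord hne with h | h
  · right; exact sub_ne_zero.mpr h.symm
  · left; exact sub_ne_zero.mpr h

theorem ne_of_orient_ne_zero {a b c : Plane} (h : orient a b c ≠ 0) : a ≠ b := by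
  rintro rfl
  apply h
  unfold orient
  ring

theorem mem_triangle {a b c x : Plane} (h : 0 < orient a b c) :
    x ∈ convexHull ℝ ({a, b, c} : Set Plane) ↔
      0 ≤ orient a b x ∧ 0 ≤ orient b c x ∧ 0 ≤ orient c a x := by
  constructor
  · intro hx
    refine ⟨convexHull_orient_nonneg ?_ hx, convexHull_orient_nonneg ?_ hx,
      convexHull_orient_nonneg ?_ hx⟩ <;>
    · rintro y (rfl | rfl | rfl) <;> unfold orient at * <;> nlinarith
  · rintro ⟨h1, h2, h3⟩
    have hsum : orient a b x + orient b c x + orient c a x = orient a b c := by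
      unfold orient; ring
    have hx : x = (orient b c x / orient a b c) • a + (orient c a x / orient a b c) • b
        + (orient a b x / orient a b c) • c := by
      have h0 := h.ne'
      ext i
      fin_cases i
      · simp
        field_simp
        unfold orient
        ring
      · simp
        field_simp
        unfold orient
        ring
    rw [hx]
    have hh := (convex_convexHull ℝ ({a, b, c} : Set Plane)).sum_mem (t := Finset.univ)
      (w := ![orient b c x / orient a b c, orient c a x / orient a b c,
        orient a b x / orient a b c]) (z := ![a, b, c]) ?_ ?_ ?_
    · simpa [Fin.sum_univ_three] using hh
    · intro i _
      fin_cases i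
      · exact div_nonneg h2 h.le
      · exact div_nonneg h3 h.le
      · exact div_nonneg h1 h.le
    · simp [Fin.sum_univ_three]
      rw [← add_div, ← add_div, div_eq_one_iff_eq h.ne']
      linarith
    · intro i _
      apply subset_convexHull
      fin_cases i <;> simp

theorem mem_interior_triangle {a b c x : Plane} (h : 0 < orient a b c) :
    x ∈ interior (convexHull ℝ ({a, b, c} : Set Plane)) ↔
      0 < orient a b x ∧ 0 < orient b c x ∧ 0 < orient c a x := by
  have hbc : 0 < orient b c a := by rwa [orient_rotate]
  have hca : 0 < orient c a b := by rwa [orient_rotate]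
  constructor
  · intro hx
    exact ⟨orient_pos_of_mem_interior (ne_of_orient_ne_zero h.ne')
        (fun y hy => ((mem_triangle h).1 hy).1) hx,
      orient_pos_of_mem_interior (ne_of_orient_ne_zero hbc.ne')
        (fun y hy => ((mem_triangle h).1 hy).2.1) hx,
      orient_pos_of_mem_interior (ne_of_orient_ne_zero hca.ne')
        (fun y hy => ((mem_triangle h).1 hy).2.2) hx⟩
  · rintro ⟨h1, h2, h3⟩
    refine mem_interior.2 ⟨{x | 0 < orient a b x} ∩ ({x | 0 < orient b c x} ∩
      {x | 0 < orient c a x}), ?_, ?_, h1, h2, h3⟩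
    · rintro y ⟨h1, h2, h3⟩
      exact (mem_triangle h).2 ⟨le_of_lt h1, le_of_lt h2, le_of_lt h3⟩
    · exact (isOpen_orient_pos _ _).inter ((isOpen_orient_pos _ _).inter (isOpen_orient_pos _ _))

theorem interior_triangle_nonempty {a b c : Plane} (h : 0 < orient a b c) :
    (interior (convexHull ℝ ({a, b, c} : Set Plane))).Nonempty := by
  refine ⟨(1 / 3 : ℝ) • (a + b + c), (mem_interior_triangle h).2 ?_⟩
  unfold orient at *
  refine ⟨?_, ?_, ?_⟩ <;> simp <;> linarith

/-- A point of a triangle with vanishing barycentric coordinate lies on the opposite side. -/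
theorem mem_segment_of_triangle {a b c x : Plane} (h : 0 < orient a b c)
    (h1 : orient a b x = 0) (h2 : 0 ≤ orient b c x) (h3 : 0 ≤ orient c a x) :
    x ∈ segment ℝ a b := by
  have hsum : orient a b x + orient b c x + orient c a x = orient a b c := by
    unfold orient; ring
  refine ⟨orient b c x / orient a b c, orient c a x / orient a b c, div_nonneg h2 h.le,
    div_nonneg h3 h.le, ?_, ?_⟩
  · rw [← add_div, div_eq_one_iff_eq h.ne']
    linarith
  · have hx : x = (orient b c x / orient a b c) • a + (orient c a x / orient a b c) • b
        + (orient a b x / orient a b c) • c := by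
      have h0 := h.ne'
      ext i
      fin_cases i
      · simp
        field_simp
        unfold orient
        ring
      · simp
        field_simp
        unfold orient
        ring
    rw [h1] at hx
    simpa using hx.symm

theorem collinear_of_orient_eq_zero {a b c : Plane} (hab : a ≠ b) (h : orient a b c = 0) :
    Collinear ℝ ({a, b, c} : Set Plane) := by
  rw [collinear_iff_of_mem (p₀ := a) (by simp)]
  have hpos : (b 0 - a 0) ^ 2 + (b 1 - a 1) ^ 2 ≠ 0 := by
    rcases ne_coord hab with h | h
    · have := sq_pos_of_ne_zero (sub_ne_zero.mpr h.symm)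
      positivity
    · have := sq_pos_of_ne_zero (sub_ne_zero.mpr h.symm)
      positivity
  refine ⟨b - a, ?_⟩
  rintro p (rfl | rfl | rfl)
  · exact ⟨0, by simp⟩
  · exact ⟨1, by simp⟩
  · refine ⟨((p 0 - a 0) * (b 0 - a 0) + (p 1 - a 1) * (b 1 - a 1)) /
      ((b 0 - a 0) ^ 2 + (b 1 - a 1) ^ 2), ?_⟩
    unfold orient at h
    ext i
    fin_cases i
    · simp
      field_simp
      linear_combination -(b 1 - a 1) * h
    · simp
      field_simp
      linear_combination (b 0 - a 0) * h

theorem orient_eq_zero_of_collinear {a b c : Plane} (h : Collinear ℝ ({a, b, c} : Set Plane)) :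
    orient a b c = 0 := by
  rw [collinear_iff_of_mem (p₀ := a) (by simp)] at h
  obtain ⟨v, hv⟩ := h
  obtain ⟨r, hr⟩ := hv b (by simp)
  obtain ⟨s, hs⟩ := hv c (by simp)
  subst hr hs
  simp [orient]
  ring

theorem NoThreeCollinear.orient_ne_zero {S : Finset Plane} (hS : NoThreeCollinear S) {a b c : Plane}
    (ha : a ∈ S) (hb : b ∈ S) (hc : c ∈ S) (hab : a ≠ b) (hac : a ≠ c) (hbc : b ≠ c) :
    orient a b c ≠ 0 :=
  fun h => hS a ha b hb c hc hab hac hbc (collinear_of_orient_eq_zero hab h)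

/-! ### Points on a parabola and chords between them. -/

/-- The points `(i, i ^ 2)` of the parabola. -/
noncomputable def parabolaPoint (i : ℕ) : Plane := !₂[(i : ℝ), (i : ℝ) ^ 2]

open Classical in
/-- The first `n` points of the parabola, a point set in convex position. -/
noncomputable def parabolaPoints (n : ℕ) : Finset Plane := (Finset.range n).image parabolaPoint

/-- The chords `ij` and `lm` (with `i < j` and `l < m`) of a convex curve cross. -/
def Crosses (i j l m : ℕ) : Prop := (i < l ∧ l < j ∧ j < m) ∨ (l < i ∧ i < m ∧ m < j)

/-- A set of pairwise noncrossing chords among `0, …, n - 1`. -/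
structure IsNoncrossing (n : ℕ) (E : Finset (ℕ × ℕ)) : Prop where
  lt : ∀ e ∈ E, e.1 < e.2
  lt_card : ∀ e ∈ E, e.2 < n
  noncrossing : ∀ e ∈ E, ∀ f ∈ E, ¬ Crosses e.1 e.2 f.1 f.2

/-- A set of pairwise noncrossing chords to which no chord can be added. -/
structure IsMaximalNoncrossing (n : ℕ) (E : Finset (ℕ × ℕ)) : Prop extends IsNoncrossing n E where
  mem_of_noncrossing : ∀ i j, i < j → j < n → (∀ e ∈ E, ¬ Crosses i j e.1 e.2) → (i, j) ∈ E

/-- The straight-line graph on the parabola with given chords. -/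
def chordGraph (E : Finset (ℕ × ℕ)) : SimpleGraph Plane where
  Adj x y := x ≠ y ∧ ∃ e ∈ E, (x = parabolaPoint e.1 ∧ y = parabolaPoint e.2) ∨
    (y = parabolaPoint e.1 ∧ x = parabolaPoint e.2)
  symm := ⟨fun _ _ ⟨h, e, he, h'⟩ => ⟨h.symm, e, he, h'.symm⟩⟩
  loopless := ⟨fun _ h => h.1 rfl⟩

theorem parabolaPoint_injective : Function.Injective parabolaPoint := by
  intro i j h
  have := congrArg (fun x : Plane => x 0) h
  simpa [parabolaPoint] using this

theorem mem_parabolaPoints {n : ℕ} {x : Plane} :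
    x ∈ parabolaPoints n ↔ ∃ i < n, parabolaPoint i = x := by
  simp [parabolaPoints]

theorem parabolaPoint_mem {n i : ℕ} (h : i < n) : parabolaPoint i ∈ parabolaPoints n :=
  mem_parabolaPoints.2 ⟨i, h, rfl⟩

theorem card_parabolaPoints (n : ℕ) : (parabolaPoints n).card = n := by
  classical
  rw [parabolaPoints, Finset.card_image_of_injective _ parabolaPoint_injective, Finset.card_range]

/-- A Vandermonde determinant: on the parabola, orientation is decided by the order of the indices,
which turns the geometry of chords into integer inequalities. -/
theorem orient_parabolaPoint (i j k : ℕ) :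
    orient (parabolaPoint i) (parabolaPoint j) (parabolaPoint k) =
      ((j : ℝ) - i) * (((k : ℝ) - i) * ((k : ℝ) - j)) := by
  simp [orient, parabolaPoint]
  ring

theorem orient_parabolaPoint_pos {i j k : ℕ} (hij : i < j) (hjk : j < k) :
    0 < orient (parabolaPoint i) (parabolaPoint j) (parabolaPoint k) := by
  rw [orient_parabolaPoint]
  have h1 : (i : ℝ) < j := by exact_mod_cast hij
  have h2 : (j : ℝ) < k := by exact_mod_cast hjk
  exact mul_pos (by linarith) (mul_pos (by linarith) (by linarith))

theorem orient_parabolaPoint_eq_zero {i j k : ℕ} (hij : i < j)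
    (h : orient (parabolaPoint i) (parabolaPoint j) (parabolaPoint k) = 0) : k = i ∨ k = j := by
  rw [orient_parabolaPoint] at h
  have h1 : (i : ℝ) < j := by exact_mod_cast hij
  rcases mul_eq_zero.1 h with h | h
  · linarith
  · rcases mul_eq_zero.1 h with h | h
    · left; exact_mod_cast sub_eq_zero.1 h
    · right; exact_mod_cast sub_eq_zero.1 h

theorem orient_parabolaPoint_nonneg {i j k : ℕ} (hij : i < j) (h : k ≤ i ∨ j ≤ k) :
    0 ≤ orient (parabolaPoint i) (parabolaPoint j) (parabolaPoint k) := by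
  rw [orient_parabolaPoint]
  have h1 : (i : ℝ) < j := by exact_mod_cast hij
  apply mul_nonneg (by linarith)
  rcases h with h | h
  · have h2 : (k : ℝ) ≤ i := by exact_mod_cast h
    exact mul_nonneg_of_nonpos_of_nonpos (by linarith) (by linarith)
  · have h2 : (j : ℝ) ≤ k := by exact_mod_cast h
    exact mul_nonneg (by linarith) (by linarith)

theorem orient_parabolaPoint_nonpos {i j k : ℕ} (hij : i < j) (h : i ≤ k ∧ k ≤ j) :
    orient (parabolaPoint i) (parabolaPoint j) (parabolaPoint k) ≤ 0 := by
  rw [orient_parabolaPoint]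
  have h1 : (i : ℝ) < j := by exact_mod_cast hij
  have h2 : (i : ℝ) ≤ k := by exact_mod_cast h.1
  have h3 : (k : ℝ) ≤ j := by exact_mod_cast h.2
  exact mul_nonpos_of_nonneg_of_nonpos (by linarith)
    (mul_nonpos_of_nonneg_of_nonpos (by linarith) (by linarith))

theorem orient_combo (p q x y : Plane) {a b : ℝ} (hab : a + b = 1) :
    orient p q (a • x + b • y) = a * orient p q x + b * orient p q y := by
  obtain rfl : b = 1 - a := by linarith
  simp [orient]
  ring

theorem orient_eq_zero_of_mem_segment {p q x : Plane} (h : x ∈ segment ℝ p q) :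
    orient p q x = 0 := by
  obtain ⟨a, b, -, -, hab, rfl⟩ := h
  rw [orient_combo _ _ _ _ hab]
  simp [orient]
  right; ring

theorem orient_nonneg_of_mem_segment {p q x y z : Plane} (h : z ∈ segment ℝ x y)
    (hx : 0 ≤ orient p q x) (hy : 0 ≤ orient p q y) : 0 ≤ orient p q z := by
  obtain ⟨a, b, ha, hb, hab, rfl⟩ := h
  rw [orient_combo _ _ _ _ hab]
  positivity

theorem orient_nonpos_of_mem_segment {p q x y z : Plane} (h : z ∈ segment ℝ x y)
    (hx : orient p q x ≤ 0) (hy : orient p q y ≤ 0) : orient p q z ≤ 0 := by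
  rw [← neg_nonneg, ← orient_swap] at *
  exact orient_nonneg_of_mem_segment h hx hy

theorem noThreeCollinear_parabolaPoints (n : ℕ) : NoThreeCollinear (parabolaPoints n) := by
  intro a ha b hb c hc hab hac hbc h
  obtain ⟨i, -, rfl⟩ := mem_parabolaPoints.1 ha
  obtain ⟨j, -, rfl⟩ := mem_parabolaPoints.1 hb
  obtain ⟨k, -, rfl⟩ := mem_parabolaPoints.1 hc
  have h0 := orient_eq_zero_of_collinear h
  rw [orient_parabolaPoint] at h0
  have h1 : (j : ℝ) - i ≠ 0 := sub_ne_zero.2 fun h => hab (by rw [Nat.cast_injective h])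
  have h2 : (k : ℝ) - i ≠ 0 := sub_ne_zero.2 fun h => hac (by rw [Nat.cast_injective h])
  have h3 : (k : ℝ) - j ≠ 0 := sub_ne_zero.2 fun h => hbc (by rw [Nat.cast_injective h])
  exact mul_ne_zero h1 (mul_ne_zero h2 h3) h0

theorem inConvexPosition_of_subset_parabolaPoints {n : ℕ} {A : Finset Plane}
    (hA : A ⊆ parabolaPoints n) : InConvexPosition A := by
  refine convexIndependent_set_iff_notMem_convexHull_sdiff.2 ?_
  intro x hx hx'
  obtain ⟨i, -, rfl⟩ := mem_parabolaPoints.1 (hA hx)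
  -- The tangent at `parabolaPoint i`, shifted upwards by one, separates it from the other points.
  have := convexHull_affine_nonneg (α := -2 * i) (β := 1) (γ := (i : ℝ) ^ 2 - 1) ?_ hx'
  · simp [parabolaPoint] at this
    nlinarith
  · rintro y ⟨hy, hne⟩
    obtain ⟨j, -, rfl⟩ := mem_parabolaPoints.1 (hA hy)
    have hij : (j : ℤ) - i ≠ 0 := by
      intro h
      apply hne
      have : j = i := by omega
      simp [this]
    have h1 : (1 : ℤ) ≤ ((j : ℤ) - i) ^ 2 := by
      have := sq_pos_of_ne_zero hij
      omega
    have h2 : (1 : ℝ) ≤ ((j : ℝ) - i) ^ 2 := by exact_mod_cast h1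
    simp [parabolaPoint]
    nlinarith

/-- Without a crossing, `l` and `m` lie on the same closed side of the line `ij`. A relative
interior point of `lm` on that line would put both ends on it, and the chords would coincide. -/
theorem mem_of_mem_chords {i j l m : ℕ} (hij : i < j) (hlm : l < m) (h : ¬ Crosses i j l m)
    (hne : ¬ (i = l ∧ j = m)) {x : Plane}
    (hx : x ∈ segment ℝ (parabolaPoint i) (parabolaPoint j))
    (hx' : x ∈ segment ℝ (parabolaPoint l) (parabolaPoint m)) :
    x = parabolaPoint l ∨ x = parabolaPoint m := by
  have h0 := orient_eq_zero_of_mem_segment hx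
  obtain ⟨a, b, ha, hb, hab, rfl⟩ := hx'
  rw [orient_combo _ _ _ _ hab] at h0
  rcases ha.eq_or_lt with rfl | ha
  · right; simp at hab; simp [hab]
  rcases hb.eq_or_lt with rfl | hb
  · left; simp at hab; simp [hab]
  exfalso
  have key : orient (parabolaPoint i) (parabolaPoint j) (parabolaPoint l) = 0 ∧
      orient (parabolaPoint i) (parabolaPoint j) (parabolaPoint m) = 0 := by
    have hcases : ((l ≤ i ∨ j ≤ l) ∧ (m ≤ i ∨ j ≤ m)) ∨ ((i ≤ l ∧ l ≤ j) ∧ (i ≤ m ∧ m ≤ j)) := by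
      unfold Crosses at h; omega
    rcases hcases with ⟨h1, h2⟩ | ⟨h1, h2⟩
    · have h1 := orient_parabolaPoint_nonneg hij h1
      have h2 := orient_parabolaPoint_nonneg hij h2
      constructor <;> nlinarith
    · have h1 := orient_parabolaPoint_nonpos hij h1
      have h2 := orient_parabolaPoint_nonpos hij h2
      constructor <;> nlinarith
  have h1 := orient_parabolaPoint_eq_zero hij key.1
  have h2 := orient_parabolaPoint_eq_zero hij key.2
  omega

theorem crosses_comm {i j l m : ℕ} : Crosses i j l m ↔ Crosses l m i j := by
  unfold Crosses; omega

theorem chordGraph_adj {E : Finset (ℕ × ℕ)} {i j : ℕ} (hij : i < j) (h : (i, j) ∈ E) :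
    (chordGraph E).Adj (parabolaPoint i) (parabolaPoint j) :=
  ⟨parabolaPoint_injective.ne hij.ne, (i, j), h, Or.inl ⟨rfl, rfl⟩⟩

theorem isCompact_triangle (a b c : Plane) :
    IsCompact (convexHull ℝ ({a, b, c} : Set Plane)) :=
  (Set.toFinite ({a, b, c} : Set Plane)).isCompact_convexHull ℝ

/-! ### Faces of noncrossing chord graphs. -/

namespace IsNoncrossing

variable {n : ℕ} {E : Finset (ℕ × ℕ)}

theorem isPlaneStraightLineGraph (h : IsNoncrossing n E) :
    IsPlaneStraightLineGraph (parabolaPoints n) (chordGraph E) := by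
  have hmeet : ∀ e ∈ E, ∀ f ∈ E, e ≠ f → ∀ x,
      x ∈ segment ℝ (parabolaPoint e.1) (parabolaPoint e.2) →
      x ∈ segment ℝ (parabolaPoint f.1) (parabolaPoint f.2) →
      x ∈ ({parabolaPoint e.1, parabolaPoint e.2} : Set Plane) ∩
        {parabolaPoint f.1, parabolaPoint f.2} := by
    intro e he f hf hne x hx hx'
    refine ⟨?_, ?_⟩
    · exact mem_of_mem_chords (h.lt f hf) (h.lt e he) (h.noncrossing f hf e he)
        (fun h => hne (Prod.ext h.1.symm h.2.symm)) hx' hx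
    · exact mem_of_mem_chords (h.lt e he) (h.lt f hf) (h.noncrossing e he f hf)
        (fun h => hne (Prod.ext h.1 h.2)) hx hx'
  constructor
  · rintro p q ⟨-, e, he, ⟨rfl, rfl⟩ | ⟨rfl, rfl⟩⟩ <;>
    have h1 := h.lt e he <;> have h2 := h.lt_card e he
    · exact ⟨parabolaPoint_mem (by omega), parabolaPoint_mem h2⟩
    · exact ⟨parabolaPoint_mem h2, parabolaPoint_mem (by omega)⟩
  · intro p q hpq v hv hvs
    obtain ⟨k, -, rfl⟩ := mem_parabolaPoints.1 hv
    obtain ⟨-, e, he, ⟨rfl, rfl⟩ | ⟨rfl, rfl⟩⟩ := hpq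
    · rcases orient_parabolaPoint_eq_zero (h.lt e he) (orient_eq_zero_of_mem_segment hvs) with
        rfl | rfl <;> simp
    · rw [segment_symm] at hvs
      rcases orient_parabolaPoint_eq_zero (h.lt e he) (orient_eq_zero_of_mem_segment hvs) with
        rfl | rfl <;> simp
  · rintro p q r s ⟨-, e, he, hpq⟩ ⟨-, f, hf, hrs⟩ hne x ⟨hx, hx'⟩
    have hef : e ≠ f := by
      rintro rfl
      apply hne
      rcases hpq with ⟨rfl, rfl⟩ | ⟨rfl, rfl⟩ <;> rcases hrs with ⟨rfl, rfl⟩ | ⟨rfl, rfl⟩ <;>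
        simp [Sym2.eq_swap]
    have key := hmeet e he f hf hef x
    rcases hpq with ⟨rfl, rfl⟩ | ⟨rfl, rfl⟩ <;> rcases hrs with ⟨rfl, rfl⟩ | ⟨rfl, rfl⟩
    · exact key hx hx'
    · rw [Set.pair_comm (parabolaPoint f.2)]
      exact key hx (by rwa [segment_symm])
    · rw [Set.pair_comm (parabolaPoint e.2)]
      exact key (by rwa [segment_symm]) hx'
    · rw [Set.pair_comm (parabolaPoint f.2), Set.pair_comm (parabolaPoint e.2)]
      exact key (by rwa [segment_symm]) (by rwa [segment_symm])

/-- Each chord that crosses no side of the triangle lies in the closed half-plane beyond one of its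
sides, as does each vertex. -/
theorem drawing_disjoint_interior (h : IsNoncrossing n E) {i k j : ℕ} (hik : (i, k) ∈ E)
    (hkj : (k, j) ∈ E) (hij : (i, j) ∈ E) {x : Plane}
    (hx : x ∈ interior (convexHull ℝ
      ({parabolaPoint i, parabolaPoint k, parabolaPoint j} : Set Plane))) :
    x ∉ drawing (parabolaPoints n) (chordGraph E) := by
  have h1 : i < k := h.lt _ hik
  have h2 : k < j := h.lt _ hkj
  have h3 : i < j := h1.trans h2
  rw [mem_interior_triangle (orient_parabolaPoint_pos h1 h2)] at hx
  obtain ⟨o1, o2, o3⟩ := hx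
  rintro (hx | ⟨p, q, ⟨-, e, he, hpq⟩, hx⟩)
  · obtain ⟨v, -, rfl⟩ := mem_parabolaPoints.1 hx
    have c1 : ¬ (i ≤ v ∧ v ≤ k) := fun hc => o1.not_ge (orient_parabolaPoint_nonpos h1 hc)
    have c2 : ¬ (k ≤ v ∧ v ≤ j) := fun hc => o2.not_ge (orient_parabolaPoint_nonpos h2 hc)
    have c3 : ¬ (v ≤ i ∨ j ≤ v) := fun hc => by
      have := orient_parabolaPoint_nonneg h3 hc
      rw [orient_swap] at o3
      linarith
    omega
  · have hx : x ∈ segment ℝ (parabolaPoint e.1) (parabolaPoint e.2) := by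
      rcases hpq with ⟨rfl, rfl⟩ | ⟨rfl, rfl⟩
      · exact hx
      · rwa [segment_symm]
    have c1 : ¬ ((i ≤ e.1 ∧ e.1 ≤ k) ∧ (i ≤ e.2 ∧ e.2 ≤ k)) := fun hc => o1.not_ge
      (orient_nonpos_of_mem_segment hx (orient_parabolaPoint_nonpos h1 hc.1)
        (orient_parabolaPoint_nonpos h1 hc.2))
    have c2 : ¬ ((k ≤ e.1 ∧ e.1 ≤ j) ∧ (k ≤ e.2 ∧ e.2 ≤ j)) := fun hc => o2.not_ge
      (orient_nonpos_of_mem_segment hx (orient_parabolaPoint_nonpos h2 hc.1)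
        (orient_parabolaPoint_nonpos h2 hc.2))
    have c3 : ¬ ((e.1 ≤ i ∨ j ≤ e.1) ∧ (e.2 ≤ i ∨ j ≤ e.2)) := fun hc => by
      have := orient_nonneg_of_mem_segment hx (orient_parabolaPoint_nonneg h3 hc.1)
        (orient_parabolaPoint_nonneg h3 hc.2)
      rw [orient_swap] at o3
      linarith
    have n1 := h.noncrossing _ hik e he
    have n2 := h.noncrossing _ hkj e he
    have n3 := h.noncrossing _ hij e he
    have := h.lt e he
    simp only [Crosses] at n1 n2 n3
    omega

theorem mem_interior_of_notMem_drawing (h : IsNoncrossing n E) {i k j : ℕ} (hik : (i, k) ∈ E)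
    (hkj : (k, j) ∈ E) (hij : (i, j) ∈ E) {x : Plane}
    (hx : x ∈ convexHull ℝ ({parabolaPoint i, parabolaPoint k, parabolaPoint j} : Set Plane))
    (hxd : x ∉ drawing (parabolaPoints n) (chordGraph E)) :
    x ∈ interior (convexHull ℝ
      ({parabolaPoint i, parabolaPoint k, parabolaPoint j} : Set Plane)) := by
  have h1 : i < k := h.lt _ hik
  have h2 : k < j := h.lt _ hkj
  have hpos := orient_parabolaPoint_pos h1 h2
  rw [mem_triangle hpos] at hx
  obtain ⟨o1, o2, o3⟩ := hx
  have hpos' := hpos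
  rw [← orient_rotate] at hpos'
  have hpos'' := hpos'
  rw [← orient_rotate] at hpos''
  refine (mem_interior_triangle hpos).2 ⟨o1.lt_of_ne ?_, o2.lt_of_ne ?_, o3.lt_of_ne ?_⟩ <;>
    intro h0 <;> apply hxd <;> right
  · exact ⟨_, _, chordGraph_adj h1 hik, mem_segment_of_triangle hpos h0.symm o2 o3⟩
  · exact ⟨_, _, chordGraph_adj h2 hkj, mem_segment_of_triangle hpos' h0.symm o3 o1⟩
  · exact ⟨_, _, (chordGraph_adj (h1.trans h2) hij).symm,
      mem_segment_of_triangle hpos'' h0.symm o1 o2⟩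

/-- The sides belong to the drawing, so off the drawing the open triangle and the complement of the
closed one form a separation. -/
theorem connectedComponentIn_eq_interior (h : IsNoncrossing n E) {i k j : ℕ} (hik : (i, k) ∈ E)
    (hkj : (k, j) ∈ E) (hij : (i, j) ∈ E) {x : Plane}
    (hx : x ∈ interior (convexHull ℝ
      ({parabolaPoint i, parabolaPoint k, parabolaPoint j} : Set Plane))) :
    connectedComponentIn (drawing (parabolaPoints n) (chordGraph E))ᶜ x =
      interior (convexHull ℝ
        ({parabolaPoint i, parabolaPoint k, parabolaPoint j} : Set Plane)) := by
  set D := drawing (parabolaPoints n) (chordGraph E)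
  set K := convexHull ℝ ({parabolaPoint i, parabolaPoint k, parabolaPoint j} : Set Plane) with hK
  have hclosed : IsClosed K := (isCompact_triangle _ _ _).isClosed
  have hsub : interior K ⊆ Dᶜ := fun y hy => h.drawing_disjoint_interior hik hkj hij hy
  apply Set.Subset.antisymm
  · apply isPreconnected_connectedComponentIn.subset_left_of_subset_union isOpen_interior
      hclosed.isOpen_compl
    · exact Set.disjoint_compl_right_iff_subset.2 interior_subset
    · intro y hy
      by_cases hyK : y ∈ K
      · left
        exact h.mem_interior_of_notMem_drawing hik hkj hij hyK
          (connectedComponentIn_subset _ _ hy)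
      · right; exact hyK
    · exact ⟨x, mem_connectedComponentIn (hsub hx), hx⟩
  · exact ((convex_convexHull ℝ _).interior.isPreconnected).subset_connectedComponentIn hx hsub

end IsNoncrossing

/-! ### Maximal noncrossing families give triangulations. -/

namespace IsMaximalNoncrossing

variable {n : ℕ} {E : Finset (ℕ × ℕ)}

theorem exists_triangle (h : IsMaximalNoncrossing n E) {i j : ℕ} (hij : (i, j) ∈ E)
    (hlt : i + 2 ≤ j) : ∃ k, (i, k) ∈ E ∧ (k, j) ∈ E := by
  classical
  have hjn := h.lt_card _ hij
  have hfirst : (i, i + 1) ∈ E := by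
    apply h.mem_of_noncrossing _ _ (by omega) (by simp at hjn; omega)
    intro e he
    have := h.lt e he
    unfold Crosses
    omega
  -- The apex is the last neighbour `k` of `i` before `j`. A chord that crosses `kj` but neither
  -- `ij` nor `ik` would join `i` to a later neighbour before `j`.
  set s := (Finset.range j).filter fun k => (i, k) ∈ E
  have hs : s.Nonempty := ⟨i + 1, by simp [s, hfirst]; omega⟩
  set k := s.max' hs
  have hk : k < j ∧ (i, k) ∈ E := by
    have := s.max'_mem hs
    rwa [Finset.mem_filter, Finset.mem_range] at this
  have hik : i < k := h.lt _ hk.2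
  refine ⟨k, hk.2, h.mem_of_noncrossing _ _ hk.1 hjn ?_⟩
  rintro ⟨l, m⟩ he hc
  have h1 := h.noncrossing _ hij _ he
  have h2 := h.noncrossing _ hk.2 _ he
  have h3 := h.lt _ he
  simp only [Crosses] at h1 h2 h3 hc
  have hil : l = i ∧ k < m ∧ m < j := by omega
  obtain ⟨rfl, hkm, hmj⟩ := hil
  have := s.le_max' m (by simp [s, he, hmj])
  omega

/-- Descent through the triangles under the chord `ij`: either `x` is in the triangle on that chord,
or it lies below one of the two shorter sides. The last hypothesis keeps `x` above the chords of
length one, where the descent would have to stop; `d` bounds `j - i`. -/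
theorem exists_mem_triangle (h : IsMaximalNoncrossing n E) {x : Plane} (d : ℕ) :
    ∀ i j : ℕ, j ≤ i + d → (i, j) ∈ E → i + 2 ≤ j →
      orient (parabolaPoint i) (parabolaPoint j) x ≤ 0 →
      (∀ l, i ≤ l → l < j → 0 ≤ orient (parabolaPoint l) (parabolaPoint (l + 1)) x) →
      ∃ a b c, (a, b) ∈ E ∧ (b, c) ∈ E ∧ (a, c) ∈ E ∧ x ∈ convexHull ℝ
        ({parabolaPoint a, parabolaPoint b, parabolaPoint c} : Set Plane) := by
  induction d with
  | zero => intro i j _ _ _; omega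
  | succ d ih =>
    intro i j hd hij hlt ho hl
    obtain ⟨k, hik, hkj⟩ := h.exists_triangle hij hlt
    have h1 : i < k := h.lt _ hik
    have h2 : k < j := h.lt _ hkj
    rcases lt_or_ge (orient (parabolaPoint i) (parabolaPoint k) x) 0 with o1 | o1
    · have hk : k ≠ i + 1 := by
        rintro rfl
        exact absurd (hl i le_rfl (by omega)) o1.not_ge
      exact ih i k (by omega) hik (by omega) o1.le fun l hil hlk => hl l hil (by omega)
    rcases lt_or_ge (orient (parabolaPoint k) (parabolaPoint j) x) 0 with o2 | o2
    · have hk : j ≠ k + 1 := by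
        rintro rfl
        exact absurd (hl k h1.le (by omega)) o2.not_ge
      exact ih k j (by omega) hkj (by omega) o2.le fun l hil hlk => hl l (by omega) hlk
    refine ⟨i, k, j, hik, hkj, hij, (mem_triangle (orient_parabolaPoint_pos h1 h2)).2
      ⟨o1, o2, ?_⟩⟩
    rw [orient_swap]
    linarith

theorem exists_mem_triangle_of_mem_convexHull (h : IsMaximalNoncrossing n E) (hn : 3 ≤ n)
    {x : Plane} (hx : x ∈ convexHull ℝ (parabolaPoints n : Set Plane)) :
    ∃ a b c, (a, b) ∈ E ∧ (b, c) ∈ E ∧ (a, c) ∈ E ∧ x ∈ convexHull ℝ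
      ({parabolaPoint a, parabolaPoint b, parabolaPoint c} : Set Plane) := by
  have hlast : (0, n - 1) ∈ E := by
    apply h.mem_of_noncrossing _ _ (by omega) (by omega)
    intro e he
    have := h.lt_card e he
    unfold Crosses
    omega
  refine h.exists_mem_triangle n 0 (n - 1) (by omega) hlast (by omega) ?_ ?_
  · rw [← neg_nonneg, ← orient_swap]
    refine convexHull_orient_nonneg ?_ hx
    intro a ha
    obtain ⟨i, hi, rfl⟩ := mem_parabolaPoints.1 (Finset.mem_coe.1 ha)
    rw [orient_swap, neg_nonneg]
    exact orient_parabolaPoint_nonpos (by omega) (by omega)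
  · intro l _ hl
    refine convexHull_orient_nonneg ?_ hx
    intro a ha
    obtain ⟨i, hi, rfl⟩ := mem_parabolaPoints.1 (Finset.mem_coe.1 ha)
    exact orient_parabolaPoint_nonneg (by omega) (by omega)

end IsMaximalNoncrossing

theorem drawing_subset_convexHull {S : Finset Plane} {G : SimpleGraph Plane}
    (h : IsPlaneStraightLineGraph S G) : drawing S G ⊆ convexHull ℝ (S : Set Plane) := by
  rintro x (hx | ⟨p, q, hpq, hx⟩)
  · exact subset_convexHull ℝ _ hx
  · exact segment_subset_convexHull (h.endpoint_mem p q hpq).1 (h.endpoint_mem p q hpq).2 hx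

/-- A line separating `x` from `K` cuts off a half-plane that contains `x`, is connected, misses `D`
and is unbounded. Hence bounded faces lie in the hull. -/
theorem not_isBounded_connectedComponentIn {K D : Set Plane} (hK : Convex ℝ K)
    (hKc : IsClosed K) (hne : K.Nonempty) (hD : D ⊆ K) {x : Plane} (hx : x ∉ K) :
    ¬ Bornology.IsBounded (connectedComponentIn Dᶜ x) := by
  intro hb
  obtain ⟨f, u, hu, hux⟩ := geometric_hahn_banach_closed_point hK hKc hx
  obtain ⟨a, ha⟩ := hne
  have hpre : IsPreconnected {y : Plane | u < f y} :=
    (convex_halfSpace_gt f.isLinear u).isPreconnected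
  have hsub : {y : Plane | u < f y} ⊆ connectedComponentIn Dᶜ x := by
    refine hpre.subset_connectedComponentIn hux ?_
    intro y hy hyD
    exact lt_asymm hy (hu y (hD hyD))
  obtain ⟨R, hR⟩ := (f.lipschitz.isBounded_image (hb.subset hsub)).exists_norm_le
  have hpos : 0 < f x - f a := by linarith [hu a ha]
  have hR0 : 0 ≤ R := (norm_nonneg _).trans (hR (f x) ⟨x, hux, rfl⟩)
  set t := (R + |f x| + 1) / (f x - f a) with ht
  have htpos : 0 < t := by positivity
  have hfy : f (x + t • (x - a)) = f x + (R + |f x| + 1) := by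
    simp [ht]
    field_simp
  have hle := hR (f (x + t • (x - a))) ⟨_, by
    change u < f _
    rw [hfy]
    linarith [abs_nonneg (f x)], rfl⟩
  rw [hfy] at hle
  have := (le_abs_self _).trans hle
  linarith [neg_abs_le (f x)]

theorem IsMaximalNoncrossing.isTriangulation {n : ℕ} {E : Finset (ℕ × ℕ)}
    (h : IsMaximalNoncrossing n E) (hn : 3 ≤ n) :
    IsTriangulation (parabolaPoints n) (chordGraph E) := by
  have hplane := h.isPlaneStraightLineGraph
  have hface : ∀ F ∈ boundedFaces (parabolaPoints n) (chordGraph E), ∃ a b c,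
      (a, b) ∈ E ∧ (b, c) ∈ E ∧ (a, c) ∈ E ∧ F = interior (convexHull ℝ
        ({parabolaPoint a, parabolaPoint b, parabolaPoint c} : Set Plane)) := by
    rintro F ⟨hb, x, hx, rfl⟩
    have hxK : x ∈ convexHull ℝ (parabolaPoints n : Set Plane) := by
      by_contra hxK
      refine not_isBounded_connectedComponentIn (convex_convexHull ℝ _)
        ((parabolaPoints n).finite_toSet.isCompact_convexHull ℝ).isClosed ?_
        (drawing_subset_convexHull hplane) hxK hb
      exact ⟨_, subset_convexHull ℝ _ (parabolaPoint_mem (i := 0) (by omega))⟩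
    obtain ⟨a, b, c, hab, hbc, hac, hxt⟩ := h.exists_mem_triangle_of_mem_convexHull hn hxK
    exact ⟨a, b, c, hab, hbc, hac, h.connectedComponentIn_eq_interior hab hbc hac
      (h.mem_interior_of_notMem_drawing hab hbc hac hxt hx)⟩
  refine ⟨noThreeCollinear_parabolaPoints n, hplane, ?_, ?_⟩
  · intro F hF
    obtain ⟨a, b, c, hab, hbc, hac, rfl⟩ := hface F hF
    exact ⟨_, _, _, chordGraph_adj (h.lt _ hab) hab, chordGraph_adj (h.lt _ hbc) hbc,
      (chordGraph_adj (h.lt _ hac) hac).symm, rfl⟩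
  · apply Set.Subset.antisymm
    · apply Set.iUnion₂_subset
      intro F hF
      obtain ⟨a, b, c, hab, hbc, hac, rfl⟩ := hface F hF
      have hbn := h.lt_card _ hab
      have hcn := h.lt_card _ hbc
      have han := h.lt _ hab
      refine (closure_mono interior_subset).trans ?_
      rw [(isCompact_triangle _ _ _).isClosed.closure_eq]
      apply convexHull_mono
      rintro x (rfl | rfl | rfl) <;> apply parabolaPoint_mem <;> simp at * <;> omega
    · intro x hx
      obtain ⟨a, b, c, hab, hbc, hac, hxt⟩ := h.exists_mem_triangle_of_mem_convexHull hn hx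
      have hne := interior_triangle_nonempty (orient_parabolaPoint_pos (h.lt _ hab) (h.lt _ hbc))
      refine Set.mem_iUnion₂.2 ⟨_, ⟨?_, hne.some, ?_,
        (h.connectedComponentIn_eq_interior hab hbc hac hne.some_mem).symm⟩, ?_⟩
      · exact (isCompact_triangle _ _ _).isBounded.subset interior_subset
      · exact h.drawing_disjoint_interior hab hbc hac hne.some_mem
      · rw [(convex_convexHull ℝ _).closure_interior_eq_closure_of_nonempty_interior hne]
        exact subset_closure hxt

theorem IsNoncrossing.exists_maximal {n : ℕ} {E : Finset (ℕ × ℕ)} (h : IsNoncrossing n E) :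
    ∃ E', E ⊆ E' ∧ IsMaximalNoncrossing n E' := by
  classical
  have hsub : ∀ E, IsNoncrossing n E → E ⊆ Finset.range n ×ˢ Finset.range n := by
    intro E h e he
    have h1 := h.lt e he
    have h2 := h.lt_card e he
    simp only [Finset.mem_product, Finset.mem_range]
    omega
  have hfin : {E | IsNoncrossing n E}.Finite :=
    (Finset.range n ×ˢ Finset.range n).powerset.finite_toSet.subset fun E hE =>
      Finset.mem_coe.2 (Finset.mem_powerset.2 (hsub E hE))
  obtain ⟨E', hle, hmax⟩ := hfin.exists_le_maximal (show E ∈ {E | IsNoncrossing n E} from h)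
  refine ⟨E', hle, hmax.prop, ?_⟩
  intro i j hij hjn hc
  have hE' : IsNoncrossing n E' := hmax.prop
  have hins : IsNoncrossing n (insert (i, j) E') := by
    refine ⟨?_, ?_, ?_⟩
    · intro e he
      rcases Finset.mem_insert.1 he with rfl | he
      · exact hij
      · exact hE'.lt e he
    · intro e he
      rcases Finset.mem_insert.1 he with rfl | he
      · exact hjn
      · exact hE'.lt_card e he
    · intro e he f hf
      rcases Finset.mem_insert.1 he with rfl | he <;> rcases Finset.mem_insert.1 hf with rfl | hf
      · unfold Crosses; omega
      · exact hc f hf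
      · rw [crosses_comm]; exact hc e he
      · exact hE'.noncrossing e he f hf
  exact hmax.le_of_ge hins (Finset.subset_insert _ _) (Finset.mem_insert_self _ _)

/-! ### Supporting lines and the edge through which a ray leaves a polygon. -/

theorem exists_supporting_functional {K : Set Plane} (hK : Convex ℝ K)
    (hne : (interior K).Nonempty) {x : Plane} (hx : x ∉ interior K) :
    ∃ α β : ℝ, (∀ y ∈ interior K, α * y 0 + β * y 1 < α * x 0 + β * x 1) ∧
      ∀ y ∈ K, α * y 0 + β * y 1 ≤ α * x 0 + β * x 1 := by
  obtain ⟨f, hf⟩ := geometric_hahn_banach_open_point hK.interior isOpen_interior hx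
  have hf' : ∀ y : Plane, f y = f !₂[1, 0] * y 0 + f !₂[0, 1] * y 1 := by
    intro y
    have : y = y 0 • (!₂[1, 0] : Plane) + y 1 • (!₂[0, 1] : Plane) := by
      ext i
      fin_cases i <;> simp
    conv_lhs => rw [this]
    simp
    ring
  refine ⟨f !₂[1, 0], f !₂[0, 1], ?_, ?_⟩
  · intro y hy
    rw [← hf', ← hf']
    exact hf y hy
  · intro y hy
    rw [← hf', ← hf']
    have h1 : K ⊆ closure (interior K) := by
      rw [hK.closure_interior_eq_closure_of_nonempty_interior hne]
      exact subset_closure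
    have h2 : closure (interior K) ⊆ {y | f y ≤ f x} :=
      closure_minimal (fun y hy => (hf y hy).le) (isClosed_le f.continuous continuous_const)
    exact h2 (h1 hy)

/-- The segment from an interior point of a convex body to a point outside leaves the body
through its boundary. -/
theorem exists_exit_point {K : Set Plane} (hK : IsCompact K) {o c : Plane} (ho : o ∈ interior K)
    (hc : c ∉ K) : ∃ t : ℝ, 0 < t ∧ t < 1 ∧ o + t • (c - o) ∈ K ∧ o + t • (c - o) ∉ interior K := by
  have hcont : Continuous fun t : ℝ => o + t • (c - o) := by fun_prop
  have hcomp : IsCompact (Set.Icc (0 : ℝ) 1 ∩ (fun t : ℝ => o + t • (c - o)) ⁻¹' K) :=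
    isCompact_Icc.inter_right (hK.isClosed.preimage hcont)
  obtain ⟨t, ⟨⟨ht0, ht1⟩, htK⟩, hmax⟩ := hcomp.exists_isGreatest
    ⟨0, by simpa using interior_subset ho⟩
  have ht1' : t ≠ 1 := by
    rintro rfl
    exact hc (by simpa using htK)
  have ht1 : t < 1 := lt_of_le_of_ne ht1 ht1'
  have hint : o + t • (c - o) ∉ interior K := by
    intro hi
    have hev : ∀ᶠ s in nhds t, o + s • (c - o) ∈ interior K :=
      hcont.continuousAt.eventually_mem (isOpen_interior.mem_nhds hi)
    obtain ⟨s, ⟨hs, hs1⟩, hst⟩ := (((hev.and (gt_mem_nhds ht1)).filter_mono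
      nhdsWithin_le_nhds).and (self_mem_nhdsWithin : Set.Ioi t ∈ nhdsWithin t (Set.Ioi t))).exists
    have hsK : o + s • (c - o) ∈ K := interior_subset hs
    have := hmax ⟨⟨ht0.trans (le_of_lt hst), le_of_lt hs1⟩, hsK⟩
    exact absurd this (not_le_of_gt hst)
  refine ⟨t, ht0.lt_of_ne ?_, ht1, htK, hint⟩
  rintro rfl
  exact hint (by simpa using ho)

/-- The segment `oc` leaves the hull at a boundary point `x`. A supporting line there contains every
point of `A` with positive weight in a convex combination giving `x`. There are at most two such
points as no three are collinear, and at least two as `oc` is generic; they span the edge. -/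
theorem exists_exit_edge {A : Finset Plane} (hA : NoThreeCollinear A) {o c : Plane}
    (ho : o ∈ interior (convexHull ℝ (A : Set Plane))) (hc : c ∉ convexHull ℝ (A : Set Plane))
    (hgen : ∀ a ∈ A, orient o a c ≠ 0) :
    ∃ p ∈ A, ∃ q ∈ A, segment ℝ p q ⊆ frontier (convexHull ℝ (A : Set Plane)) ∧
      0 < orient o p c ∧ 0 < orient o c q ∧ 0 < orient o p q ∧
      (∀ y ∈ convexHull ℝ (A : Set Plane), 0 ≤ orient p q y) ∧ orient p q c < 0 := by
  have hcomp := A.finite_toSet.isCompact_convexHull ℝ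
  obtain ⟨t, ht0, ht1, hxK, hxi⟩ := exists_exit_point hcomp ho hc
  obtain ⟨α, β, hint, hle⟩ := exists_supporting_functional (convex_convexHull ℝ _) ⟨o, ho⟩ hxi
  obtain ⟨w, hw0, hw1, hwx⟩ := Finset.mem_convexHull'.1 hxK
  set x := o + t • (c - o) with hx
  have hx0 : x 0 = o 0 + t * (c 0 - o 0) := by simp [hx]
  have hx1 : x 1 = o 1 + t * (c 1 - o 1) := by simp [hx]
  have hsupp : ∀ a ∈ A, 0 < w a → α * a 0 + β * a 1 = α * x 0 + β * x 1 := by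
    have hsum : ∑ a ∈ A, w a * (α * x 0 + β * x 1 - (α * a 0 + β * a 1)) = 0 := by
      have e0 : ∑ a ∈ A, w a * a 0 = x 0 := by rw [← hwx]; simp
      have e1 : ∑ a ∈ A, w a * a 1 = x 1 := by rw [← hwx]; simp
      have : ∀ a ∈ A, w a * (α * x 0 + β * x 1 - (α * a 0 + β * a 1)) =
          w a * (α * x 0 + β * x 1) - α * (w a * a 0) - β * (w a * a 1) := fun a _ => by ring
      rw [Finset.sum_congr rfl this, Finset.sum_sub_distrib, Finset.sum_sub_distrib,
        ← Finset.sum_mul, ← Finset.mul_sum, ← Finset.mul_sum, hw1, e0, e1]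
      ring
    intro a ha hwa
    have := (Finset.sum_eq_zero_iff_of_nonneg fun b hb => mul_nonneg (hw0 b hb)
      (sub_nonneg.2 (hle b (subset_convexHull ℝ _ hb)))).1 hsum a ha
    rcases mul_eq_zero.1 this with h | h
    · exact absurd h hwa.ne'
    · linarith
  have hlo := hint o ho
  have hlc : α * x 0 + β * x 1 < α * c 0 + β * c 1 := by
    rw [hx0, hx1] at hlo ⊢
    nlinarith
  have hfin : ∀ (p q : Plane) (u v : ℝ), p ∈ A → q ∈ A → 0 < u → 0 < v → u + v = 1 → u • p + v • q = x →
      α * p 0 + β * p 1 = α * x 0 + β * x 1 → α * q 0 + β * q 1 = α * x 0 + β * x 1 →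
      0 < orient o p q →
      ∃ p ∈ A, ∃ q ∈ A, segment ℝ p q ⊆ frontier (convexHull ℝ (A : Set Plane)) ∧
      0 < orient o p c ∧ 0 < orient o c q ∧ 0 < orient o p q ∧
      (∀ y ∈ convexHull ℝ (A : Set Plane), 0 ≤ orient p q y) ∧ orient p q c < 0 := by
    intro p q u v hp hq hu hv huv hpq hLp hLq ho'
    have e0 : u * p 0 + v * q 0 = o 0 + t * (c 0 - o 0) := by rw [← hx0, ← hpq]; simp
    have e1 : u * p 1 + v * q 1 = o 1 + t * (c 1 - o 1) := by rw [← hx1, ← hpq]; simp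
    obtain rfl : u = 1 - v := by linarith
    have h1 : t * orient o p c = v * orient o p q := by
      unfold orient
      linear_combination -(p 0 - o 0) * e1 + (p 1 - o 1) * e0
    have h2 : t * orient o c q = (1 - v) * orient o p q := by
      unfold orient
      linear_combination (q 0 - o 0) * e1 - (q 1 - o 1) * e0
    -- The supporting line is the line `pq`, so `orient p q` is a multiple of the deficit of the
    -- functional; the value at `o` fixes the factor.
    have key : ∀ y : Plane, orient p q y * (α * x 0 + β * x 1 - (α * o 0 + β * o 1)) =
        (α * x 0 + β * x 1 - (α * y 0 + β * y 1)) * orient o p q := by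
      intro y
      rw [← hLp] at hLq ⊢
      unfold orient
      linear_combination -((o 0 - p 0) * (y 1 - p 1) - (o 1 - p 1) * (y 0 - p 0)) * hLq
    refine ⟨p, hp, q, hq, ?_, ?_, ?_, ho', ?_, ?_⟩
    · intro y hy
      have hyK : y ∈ convexHull ℝ (A : Set Plane) := segment_subset_convexHull hp hq hy
      rw [hcomp.isClosed.frontier_eq]
      refine ⟨hyK, fun hyi => (hint y hyi).ne ?_⟩
      obtain ⟨a, b, -, -, hab, rfl⟩ := hy
      obtain rfl : b = 1 - a := by linarith
      simp
      linear_combination a * hLp + (1 - a) * hLq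
    · exact pos_of_mul_pos_right (h1 ▸ mul_pos hv ho') ht0.le
    · exact pos_of_mul_pos_right (h2 ▸ mul_pos hu ho') ht0.le
    · intro y hy
      have h3 := mul_nonneg (sub_nonneg.2 (hle y hy)) ho'.le
      rw [← key] at h3
      exact nonneg_of_mul_nonneg_left h3 (sub_pos.2 hlo)
    · have h3 := mul_neg_of_neg_of_pos (sub_neg.2 hlc) ho'
      rw [← key] at h3
      exact neg_of_mul_neg_left h3 (sub_pos.2 hlo).le
  obtain ⟨p, hp, hwp⟩ : ∃ p ∈ A, 0 < w p := by
    by_contra! h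
    have := Finset.sum_nonpos h
    linarith
  obtain ⟨q, hq, hqp, hwq⟩ : ∃ q ∈ A, q ≠ p ∧ 0 < w q := by
    by_contra! h
    have h0 : ∀ a ∈ A, a ≠ p → w a = 0 := fun a ha hap => le_antisymm (h a ha hap) (hw0 a ha)
    have hwp1 : w p = 1 := by
      rw [← hw1]
      exact (Finset.sum_eq_single p h0 fun hn => absurd hp hn).symm
    have hxp : x = p := by
      rw [← hwx, Finset.sum_eq_single p (fun a ha hap => by rw [h0 a ha hap, zero_smul])
        fun hn => absurd hp hn, hwp1, one_smul]
    apply hgen p hp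
    have e0 := congrArg (fun y : Plane => y 0) hxp
    have e1 := congrArg (fun y : Plane => y 1) hxp
    simp only [hx0, hx1] at e0 e1
    unfold orient
    rw [← e0, ← e1]
    ring
  have h0 : ∀ a ∈ A, a ≠ p ∧ a ≠ q → w a = 0 := by
    rintro a ha ⟨hap, haq⟩
    by_contra hwa
    have hwa : 0 < w a := (hw0 a ha).lt_of_ne (Ne.symm hwa)
    have l1 := hsupp a ha hwa
    have l2 := hsupp p hp hwp
    have l3 := hsupp q hq hwq
    apply hA.orient_ne_zero hp hq ha hqp.symm hap.symm haq.symm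
    have h4 : orient p q a * (α * x 0 + β * x 1 - (α * o 0 + β * o 1)) = 0 := by
      rw [← l2] at l1 l3 ⊢
      unfold orient
      linear_combination -((o 0 - p 0) * (a 1 - p 1) - (o 1 - p 1) * (a 0 - p 0)) * l3
        - ((q 0 - p 0) * (o 1 - p 1) - (q 1 - p 1) * (o 0 - p 0)) * l1
    exact (mul_eq_zero.1 h4).resolve_right (sub_pos.2 hlo).ne'
  have hw1' : w p + w q = 1 := by
    rw [← hw1, Finset.sum_eq_add p q hqp.symm h0 (fun h => absurd hp h) fun h => absurd hq h]
  have hwx' : w p • p + w q • q = x := by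
    rw [← hwx, Finset.sum_eq_add p q hqp.symm (fun a ha h => by rw [h0 a ha h, zero_smul])
      (fun h => absurd hp h) fun h => absurd hq h]
  have hopq : orient o p q ≠ 0 := by
    intro h
    have h1 : t * orient o p c = w q * orient o p q := by
      have e0 : w p * p 0 + w q * q 0 = o 0 + t * (c 0 - o 0) := by rw [← hx0, ← hwx']; simp
      have e1 : w p * p 1 + w q * q 1 = o 1 + t * (c 1 - o 1) := by rw [← hx1, ← hwx']; simp
      have hw2 : w p = 1 - w q := by linarith
      rw [hw2] at e0 e1
      unfold orient
      linear_combination -(p 0 - o 0) * e1 + (p 1 - o 1) * e0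
    rw [h, mul_zero] at h1
    exact hgen p hp ((mul_eq_zero.1 h1).resolve_left ht0.ne')
  rcases hopq.lt_or_gt with h | h
  · refine hfin q p (w q) (w p) hq hp hwq hwp (by linarith) (by rw [add_comm]; exact hwx')
      (hsupp q hq hwq) (hsupp p hp hwp) ?_
    have : orient o q p = - orient o p q := by unfold orient; ring
    linarith
  · exact hfin p q (w p) (w q) hp hq hwp hwq hw1' hwx' (hsupp p hp hwp) (hsupp q hq hwq) h

/-! ### Gaps of polygons around a common point do not cross. -/

theorem NoThreeCollinear.subset {S A : Finset Plane} (hS : NoThreeCollinear S) (hA : A ⊆ S) :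
    NoThreeCollinear A :=
  fun a ha b hb c hc => hS a (hA ha) b (hA hb) c (hA hc)

theorem orient_plucker (o a b c d : Plane) :
    orient o a b * orient o c d - orient o a c * orient o b d + orient o a d * orient o b c = 0 := by
  unfold orient; ring

/-- A point in the cone spanned by `p` and `q` at which the functional that is `1` on the
line `pq` takes the positive value `g` is, after scaling by `1 / g`, on the segment `pq`. -/
theorem scaled_mem_segment {o p q x : Plane} {g : ℝ} (hpq : 0 < orient o p q)
    (hp : 0 ≤ orient o p x) (hq : 0 ≤ orient o x q) (hg : 0 < g)
    (h : orient o x q + orient o p x = g * orient o p q) :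
    o + g⁻¹ • (x - o) ∈ segment ℝ p q := by
  refine ⟨orient o x q / (g * orient o p q), orient o p x / (g * orient o p q),
    by positivity, by positivity, ?_, ?_⟩
  · rw [← add_div, h, div_self (by positivity)]
  · have h0 := hpq.ne'
    have h1 := hg.ne'
    have key : ∀ i : Fin 2, orient o x q * p i + orient o p x * q i =
        g * orient o p q * o i + orient o p q * (x i - o i) := by
      intro i
      rw [← h]
      fin_cases i <;> simp [orient] <;> ring
    ext i
    have := key i
    simp
    field_simp
    linarith

/-- Two crossing arcs (seen from `o`) cannot both be gaps between consecutive points of convex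
polygons of a plane graph that contain `o`. -/
theorem not_crossing_gaps {S : Finset Plane} {G : SimpleGraph Plane} (hS : NoThreeCollinear S)
    (hG : IsPlaneStraightLineGraph S G) {A B : Finset Plane} (hAS : A ⊆ S) (hBS : B ⊆ S)
    (hA : boundaryCycle A ≤ G) (hB : boundaryCycle B ≤ G) {o : Plane}
    (hgen : ∀ a ∈ S, ∀ b ∈ S, a ≠ b → orient o a b ≠ 0)
    (hoA : o ∈ interior (convexHull ℝ (A : Set Plane)))
    (hoB : o ∈ interior (convexHull ℝ (B : Set Plane))) {a b c d : Plane}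
    (hbS : b ∈ S) (hcS : c ∈ S)
    (hbA : b ∈ convexHull ℝ (A : Set Plane)) (hcB : c ∈ convexHull ℝ (B : Set Plane))
    (gapA : ∀ x ∈ S, x ∈ convexHull ℝ (A : Set Plane) → 0 < orient o a x → ¬ 0 < orient o x b)
    (gapB : ∀ x ∈ S, x ∈ convexHull ℝ (B : Set Plane) → 0 < orient o c x → ¬ 0 < orient o x d)
    (hab : 0 < orient o a b) (hcd : 0 < orient o c d) (hac : 0 < orient o a c)
    (hcb : 0 < orient o c b) (hbd : 0 < orient o b d) : False := by
  have hcA : c ∉ convexHull ℝ (A : Set Plane) := fun h => gapA c hcS h hac hcb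
  have hbB : b ∉ convexHull ℝ (B : Set Plane) := fun h => gapB b hbS h hcb hbd
  have swap : ∀ x y, orient o x y = - orient o y x := fun x y => by unfold orient; ring
  obtain ⟨p, hp, q, hq, hfpq, hpc, hcq, hpq, hApq, hcpq⟩ := exists_exit_edge (hS.subset hAS) hoA hcA
    fun a ha => hgen a (hAS ha) c hcS fun h => hcA (h ▸ subset_convexHull ℝ _ ha)
  obtain ⟨r, hr, s, hs, hfrs, hrb, hbs, hrs, hBrs, hbrs⟩ :=
    exists_exit_edge (hS.subset hBS) hoB hbB
    fun a ha => hgen a (hBS ha) b hbS fun h => hbB (h ▸ subset_convexHull ℝ _ ha)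
  -- If `q` came before `b`, it would be a point of `A` inside the gap from `a` to `b`. So the cone
  -- over `pq` contains the direction of `b` as well as that of `c`; the same holds for `rs`.
  have hbq : 0 ≤ orient o b q := by
    by_contra! h
    have hqb : 0 < orient o q b := by rw [swap]; linarith
    refine gapA q (hAS hq) (subset_convexHull ℝ _ hq) ?_ hqb
    have := orient_plucker o a c q b
    nlinarith [mul_pos hac hqb, mul_pos hab hcq]
  have hpb : 0 < orient o p b := by
    have := orient_plucker o p c b q
    nlinarith [mul_nonneg hpc.le hbq, mul_pos hpq hcb]
  have hrc : 0 ≤ orient o r c := by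
    by_contra! h
    have hcr : 0 < orient o c r := by rw [swap]; linarith
    refine gapB r (hBS hr) (subset_convexHull ℝ _ hr) hcr ?_
    have := orient_plucker o c r b d
    nlinarith [mul_pos hcr hbd, mul_pos hcd hrb]
  have hcs : 0 < orient o c s := by
    have := orient_plucker o r c b s
    nlinarith [mul_nonneg hrc hbs.le, mul_pos hrs hcb]
  have hpqne : p ≠ q := by rintro rfl; simp [orient] at hpq; linarith
  have hrsne : r ≠ s := by rintro rfl; simp [orient] at hrs; linarith
  have hadj : G.Adj p q := hA ⟨hpqne, hp, hq, hfpq⟩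
  have hadj' : G.Adj r s := hB ⟨hrsne, hr, hs, hfrs⟩
  -- affine forms that are negative beyond the edges `pq` and `rs`
  have e1 : ∀ p q y, orient p q y = orient o p q - (orient o y q + orient o p y) := fun p q y => by
    unfold orient; ring
  have hbpq := hApq b hbA
  have hcrs := hBrs c hcB
  rw [e1] at hcpq hbrs hbpq hcrs
  -- The edges differ, since `c` lies beyond `pq` but not beyond `rs`.
  by_cases hne : s(p, q) = s(r, s)
  · rcases Sym2.eq_iff.1 hne with ⟨rfl, rfl⟩ | ⟨rfl, rfl⟩
    · linarith
    · rw [swap] at hrs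
      linarith
  -- Up to a positive factor, `u` and `v` compare the forms that are `0` at `o` and `1` on `pq` or
  -- on `rs`: at `c` the form of `pq` is larger, at `b` that of `rs`. At the point `x` of the
  -- segment `cb` weighted by `v` and `u` they agree, so the ray from `o` through `x` meets both
  -- edges in one point.
  set u := orient o r s * (orient o c q + orient o p c) -
    orient o p q * (orient o c s + orient o r c) with hu
  set v := orient o p q * (orient o b s + orient o r b) -
    orient o r s * (orient o b q + orient o p b) with hv
  have hupos : 0 < u := by rw [hu]; nlinarith
  have hvpos : 0 < v := by rw [hv]; nlinarith
  set x : Plane := (v / (u + v)) • c + (u / (u + v)) • b with hx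
  have hcomb : v / (u + v) + u / (u + v) = 1 := by
    rw [← add_div, add_comm, div_self (by positivity)]
  have hvs : 0 < v / (u + v) := by positivity
  have hus : 0 < u / (u + v) := by positivity
  have l1 : ∀ p, orient o p x = v / (u + v) * orient o p c + u / (u + v) * orient o p b :=
    fun p => orient_combo o p c b hcomb
  have l2 : ∀ q, orient o x q = v / (u + v) * orient o c q + u / (u + v) * orient o b q := by
    intro q
    rw [swap, l1, swap c, swap b]
    ring
  have hpx : 0 < orient o p x := by rw [l1]; positivity
  have hxq : 0 < orient o x q := by rw [l2]; positivity
  have hrx : 0 < orient o r x := by rw [l1]; positivity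
  have hxs : 0 < orient o x s := by rw [l2]; positivity
  set g := (orient o x q + orient o p x) / orient o p q with hg
  have hgpos : 0 < g := by positivity
  have hg1 : orient o x q + orient o p x = g * orient o p q := by
    rw [hg]; field_simp
  have hg2 : orient o x s + orient o r x = g * orient o r s := by
    have : (orient o x s + orient o r x) * orient o p q =
        (orient o x q + orient o p x) * orient o r s := by
      have huv : u + v ≠ 0 := by positivity
      rw [l1, l2, l1, l2]
      field_simp
      rw [hu, hv]
      ring
    rw [hg, div_mul_eq_mul_div, eq_div_iff hpq.ne', this]
  have hy1 := scaled_mem_segment hpq hpx.le hxq.le hgpos hg1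
  have hy2 := scaled_mem_segment hrs hrx.le hxs.le hgpos hg2
  have hscale : ∀ z : Plane, orient o z (o + g⁻¹ • (x - o)) = g⁻¹ * orient o z x := by
    intro z
    simp [orient]
    ring
  have hginv := inv_pos.2 hgpos
  -- Planarity makes the common point an endpoint of `pq`, but its direction is strictly between
  -- those of `p` and `q`.
  rcases (hG.noncrossing p q r s hadj hadj' hne ⟨hy1, hy2⟩).1 with h | h
  · have := hscale p
    rw [h] at this
    have h0 : orient o p p = 0 := by unfold orient; ring
    rw [h0] at this
    have := mul_pos hginv hpx
    linarith
  · have := hscale q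
    rw [Set.mem_singleton_iff.1 h] at this
    have h0 : orient o q q = 0 := by unfold orient; ring
    rw [h0, swap q x] at this
    have := mul_pos hginv hxq
    linarith

/-- A supporting line at the midpoint of a boundary chord `ij` contains the chord, but `k` and `l`
lie strictly on opposite sides of it. In coordinates, `k` forces `β ≥ 0` and `l` forces `β ≤ 0`. -/
theorem not_crossing_of_boundaryCycle_adj {B : Finset Plane} {i j k l : ℕ} (hik : i < k)
    (hkj : k < j) (hl : l < i ∨ j < l) (hk : parabolaPoint k ∈ B) (hlB : parabolaPoint l ∈ B) :
    ¬ (boundaryCycle B).Adj (parabolaPoint i) (parabolaPoint j) := by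
  rintro ⟨-, hi, hj, hf⟩
  have hne : (interior (convexHull ℝ (B : Set Plane))).Nonempty := by
    refine (interior_triangle_nonempty (orient_parabolaPoint_pos hik hkj)).mono
      (interior_mono (convexHull_mono ?_))
    rintro x (rfl | rfl | rfl) <;> assumption
  set x : Plane := (1 / 2 : ℝ) • parabolaPoint i + (1 / 2 : ℝ) • parabolaPoint j with hx
  have hxf := hf ⟨1 / 2, 1 / 2, by norm_num, by norm_num, by norm_num, hx.symm⟩
  obtain ⟨α, β, hlt, hle⟩ := exists_supporting_functional (convex_convexHull ℝ _) hne hxf.2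
  obtain ⟨y, hy⟩ := hne
  have hlt := hlt y hy
  have hi' := hle _ (subset_convexHull ℝ _ hi)
  have hj' := hle _ (subset_convexHull ℝ _ hj)
  have hk' := hle _ (subset_convexHull ℝ _ hk)
  have hl' := hle _ (subset_convexHull ℝ _ hlB)
  simp [hx, parabolaPoint] at hi' hj' hk' hl' hlt
  have h1 : (i : ℝ) < k := by exact_mod_cast hik
  have h2 : (k : ℝ) < j := by exact_mod_cast hkj
  have hαβ : α + β * (i + j) = 0 := by
    have : ((j : ℝ) - i) * (α + β * (i + j)) = 0 := by linarith
    exact (mul_eq_zero.1 this).resolve_left (by linarith)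
  obtain rfl : α = - (β * (i + j)) := by linarith
  have hβ : 0 ≤ β := by
    have h3 : 0 ≤ β * (((k : ℝ) - i) * (j - k)) := by linarith
    exact nonneg_of_mul_nonneg_left h3 (mul_pos (by linarith) (by linarith))
  have hβ' : β ≤ 0 := by
    have h3 : β * (((l : ℝ) - i) * (l - j)) ≤ 0 := by linarith
    refine nonpos_of_mul_nonpos_left h3 ?_
    rcases hl with hl | hl
    · have : (l : ℝ) < i := by exact_mod_cast hl
      exact mul_pos_of_neg_of_neg (by linarith) (by linarith)
    · have : (j : ℝ) < l := by exact_mod_cast hl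
      exact mul_pos (by linarith) (by linarith)
  obtain rfl : β = 0 := le_antisymm hβ' hβ
  simp at hlt

/-! ### Angular order and gaps around a point. -/

/-- A function that orders the points of `S` by their direction as seen from `o`. -/
structure IsAngularOrder (S : Finset Plane) (o : Plane) (θ : Plane → ℝ) : Prop where
  orient_pos : ∀ x ∈ S, ∀ y ∈ S, θ x < θ y → θ y < θ x + Real.pi → 0 < orient o x y
  orient_pos' : ∀ x ∈ S, ∀ y ∈ S, θ x + Real.pi < θ y → 0 < orient o y x
  lt_add_two_pi : ∀ x ∈ S, ∀ y ∈ S, θ y < θ x + 2 * Real.pi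
  injOn : ∀ x ∈ S, ∀ y ∈ S, θ x = θ y → x = y
  ne_add_pi : ∀ x ∈ S, ∀ y ∈ S, θ y ≠ θ x + Real.pi

theorem orient_antisymm (o x y : Plane) : orient o x y = - orient o y x := by
  unfold orient; ring

theorem orient_apex_self (o x : Plane) : orient o x x = 0 := by
  unfold orient; ring

theorem exists_isAngularOrder {S : Finset Plane} {o : Plane} (ho : o ∉ S)
    (hgen : ∀ a ∈ S, ∀ b ∈ S, a ≠ b → orient o a b ≠ 0) : ∃ θ, IsAngularOrder S o θ := by
  -- The angle is the complex argument of `x - o`; `orient o x y` is the product of the moduli and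
  -- the sine of the angle difference.
  set z : Plane → ℂ := fun x => ⟨x 0 - o 0, x 1 - o 1⟩ with hz
  have hnorm : ∀ x ∈ S, 0 < ‖z x‖ := by
    intro x hx
    rw [norm_pos_iff]
    intro h
    apply ho
    convert hx
    have h0 := congrArg Complex.re h
    have h1 := congrArg Complex.im h
    simp [hz] at h0 h1
    ext i
    fin_cases i
    · simp; linarith
    · simp; linarith
  have key : ∀ x y, orient o x y = ‖z x‖ * ‖z y‖ * Real.sin ((z y).arg - (z x).arg) := by
    intro x y
    have h1 := Complex.norm_mul_cos_arg (z x)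
    have h2 := Complex.norm_mul_sin_arg (z x)
    have h3 := Complex.norm_mul_cos_arg (z y)
    have h4 := Complex.norm_mul_sin_arg (z y)
    have h5 : orient o x y = (z x).re * (z y).im - (z x).im * (z y).re := by simp [orient, hz]
    rw [h5, ← h1, ← h2, ← h3, ← h4, Real.sin_sub]
    ring
  have hrange : ∀ x y, (z y).arg < (z x).arg + 2 * Real.pi := fun x y => by
    linarith [Complex.arg_le_pi (z y), Complex.neg_pi_lt_arg (z x)]
  have hpi := Real.pi_pos
  refine ⟨fun x => (z x).arg, ?_, ?_, fun x _ y _ => hrange x y, ?_, ?_⟩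
  · intro x hx y hy h1 h2
    rw [key]
    exact mul_pos (mul_pos (hnorm x hx) (hnorm y hy))
      (Real.sin_pos_of_pos_of_lt_pi (by linarith) (by linarith))
  · intro x hx y hy h1
    rw [orient_antisymm, key, ← mul_neg, ← Real.sin_sub_pi]
    exact mul_pos (mul_pos (hnorm x hx) (hnorm y hy))
      (Real.sin_pos_of_pos_of_lt_pi (by linarith) (by linarith [hrange x y]))
  · intro x hx y hy h
    by_contra hne
    apply hgen x hx y hy hne
    rw [key, h, sub_self, Real.sin_zero, mul_zero]
  · intro x hx y hy h
    apply hgen x hx y hy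
    · rintro rfl
      linarith
    · rw [key, h, add_sub_cancel_left, Real.sin_pi, mul_zero]

theorem exists_rank (S : Finset Plane) (θ : Plane → ℝ) :
    ∃ φ : Plane → ℕ, (∀ x ∈ S, φ x < S.card) ∧ ∀ x ∈ S, ∀ y ∈ S, φ x < φ y ↔ θ x < θ y := by
  classical
  have hmono : ∀ x ∈ S, ∀ y ∈ S, θ x < θ y →
      (S.filter fun z => θ z < θ x).card < (S.filter fun z => θ z < θ y).card := by
    intro x hx y hy h
    apply Finset.card_lt_card
    rw [Finset.ssubset_iff_of_subset]
    · exact ⟨x, by simp [hx, h], by simp⟩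
    · intro z hz
      simp only [Finset.mem_filter] at hz ⊢
      exact ⟨hz.1, hz.2.trans h⟩
  have hmono' : ∀ x ∈ S, ∀ y ∈ S, θ x ≤ θ y →
      (S.filter fun z => θ z < θ x).card ≤ (S.filter fun z => θ z < θ y).card := by
    intro x hx y hy h
    apply Finset.card_le_card
    intro z hz
    simp only [Finset.mem_filter] at hz ⊢
    exact ⟨hz.1, hz.2.trans_le h⟩
  refine ⟨fun x => (S.filter fun z => θ z < θ x).card, ?_, ?_⟩
  · intro x hx
    apply Finset.card_lt_card
    rw [Finset.ssubset_iff_of_subset (Finset.filter_subset _ _)]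
    exact ⟨x, hx, by simp⟩
  · intro x hx y hy
    refine ⟨fun h => ?_, hmono x hx y hy⟩
    by_contra hc
    exact absurd (hmono' y hy x hx (not_lt.1 hc)) (not_le_of_gt h)

/-- `b` follows `a` in the counterclockwise order around `o` of the points of `S` in the convex
hull of `A`, with an angle less than `π`. -/
def IsGap (S : Finset Plane) (o : Plane) (A : Finset Plane) (a b : Plane) : Prop :=
  a ∈ convexHull ℝ (A : Set Plane) ∧ b ∈ convexHull ℝ (A : Set Plane) ∧ 0 < orient o a b ∧
    ∀ x ∈ S, x ∈ convexHull ℝ (A : Set Plane) → 0 < orient o a x → ¬ 0 < orient o x b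

open Classical in
/-- The convex polygons of the graph that contain `o` in their interior. -/
noncomputable def polygonsAround (S : Finset Plane) (G : SimpleGraph Plane) (o : Plane) :
    Finset (Finset Plane) :=
  {A ∈ convexPolygons S G | o ∈ interior (convexHull ℝ (A : Set Plane))}

theorem mem_convexPolygons {S : Finset Plane} {G : SimpleGraph Plane} {A : Finset Plane} :
    A ∈ convexPolygons S G ↔
      A ⊆ S ∧ 3 ≤ A.card ∧ InConvexPosition A ∧ boundaryCycle A ≤ G := by
  simp [convexPolygons]

theorem mem_polygonsAround {S : Finset Plane} {G : SimpleGraph Plane} {o : Plane}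
    {A : Finset Plane} : A ∈ polygonsAround S G o ↔
      A ∈ convexPolygons S G ∧ o ∈ interior (convexHull ℝ (A : Set Plane)) := by
  simp [polygonsAround]

/-- The extreme points of the common hull lie in both sets and already span it, so a point of `A`
outside `B` would be in the hull of the other points of `A`. -/
theorem subset_of_convexHull_eq {A B : Finset Plane} (hA : InConvexPosition A)
    (h : convexHull ℝ (A : Set Plane) = convexHull ℝ (B : Set Plane)) : A ⊆ B := by
  set X := (convexHull ℝ (A : Set Plane)).extremePoints ℝ with hX
  have hXA : X ⊆ A := extremePoints_convexHull_subset
  have hXB : X ⊆ B := by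
    rw [hX, h]
    exact extremePoints_convexHull_subset
  have hKM : convexHull ℝ X = convexHull ℝ (A : Set Plane) := by
    have := closure_convexHull_extremePoints (A.finite_toSet.isCompact_convexHull ℝ)
      (convex_convexHull ℝ _)
    rwa [((A.finite_toSet.subset hXA).isCompact_convexHull ℝ).isClosed.closure_eq] at this
  intro a ha
  by_contra hab
  have hA' := convexIndependent_set_iff_notMem_convexHull_sdiff.1 hA a ha
  apply hA'
  refine convexHull_mono (s := X) ?_ (hKM ▸ subset_convexHull ℝ _ ha)
  intro x hx
  refine ⟨hXA hx, ?_⟩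
  rintro rfl
  exact hab (hXB hx)

theorem exists_orient_neg {K : Set Plane} {o b : Plane} (ho : o ∈ interior K) (hob : o ≠ b) :
    ∃ x ∈ K, orient o b x < 0 := by
  by_contra! h
  have := orient_pos_of_mem_interior hob h ho
  simp [orient] at this

section

variable {S : Finset Plane} {o : Plane} {θ : Plane → ℝ}

theorem exists_orient_neg_of_polygon (A : Finset Plane) (hAS : A ⊆ S)
    (hoA : o ∈ interior (convexHull ℝ (A : Set Plane))) {b : Plane} (hob : o ≠ b) :
    ∃ x ∈ S, x ∈ convexHull ℝ (A : Set Plane) ∧ orient o b x < 0 := by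
  by_contra! h
  obtain ⟨x, hx, hneg⟩ := exists_orient_neg hoA hob
  exact hneg.not_ge
    (convexHull_orient_nonneg (fun a ha => h a (hAS ha) (subset_convexHull ℝ _ ha)) hx)

/-- The angle is less than `π` because `o` is interior to the hull, so the points of `S` in the hull
do not all lie in a closed half-plane bounded by a line through `o`. -/
theorem isGap_of_none_between (hθ : IsAngularOrder S o θ) (ho : o ∉ S) {A : Finset Plane}
    (hAS : A ⊆ S) (hoA : o ∈ interior (convexHull ℝ (A : Set Plane))) {a b : Plane} (ha : a ∈ S)
    (hb : b ∈ S) (haA : a ∈ convexHull ℝ (A : Set Plane)) (hbA : b ∈ convexHull ℝ (A : Set Plane))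
    (hab : θ a < θ b)
    (h : ∀ c ∈ S, c ∈ convexHull ℝ (A : Set Plane) → ¬ (θ a < θ c ∧ θ c < θ b)) :
    IsGap S o A a b := by
  have hlt : θ b < θ a + Real.pi := by
    by_contra hc
    have hgt := (not_lt.1 hc).lt_of_ne (hθ.ne_add_pi a ha b hb).symm
    obtain ⟨x, hxS, hxA, hx⟩ := exists_orient_neg_of_polygon A hAS hoA (b := b)
      (fun h => ho (h ▸ hb))
    rcases lt_trichotomy (θ x) (θ b) with h1 | h1 | h1
    · have h2 : θ x ≤ θ a := by
        by_contra h3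
        exact h x hxS hxA ⟨not_le.1 h3, h1⟩
      exact hx.not_gt (hθ.orient_pos' x hxS b hb (by linarith))
    · rw [hθ.injOn x hxS b hb h1, orient_apex_self] at hx
      exact lt_irrefl _ hx
    · exact hx.not_gt (hθ.orient_pos b hb x hxS h1 (by linarith [hθ.lt_add_two_pi a ha x hxS]))
  refine ⟨haA, hbA, hθ.orient_pos a ha b hb hab hlt, ?_⟩
  intro c hc hcA hac hcb
  have h0 := h c hc hcA
  rw [orient_antisymm] at hac hcb
  rcases lt_trichotomy (θ c) (θ a) with h1 | h1 | h1
  · have h2 : θ c + Real.pi < θ a := by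
      by_contra h2
      have := hθ.orient_pos c hc a ha h1
        ((not_lt.1 h2).lt_of_ne (hθ.ne_add_pi c hc a ha))
      linarith
    have := hθ.orient_pos' c hc b hb (by linarith)
    linarith
  · rw [hθ.injOn c hc a ha h1, orient_apex_self] at hac
    linarith
  · rcases lt_trichotomy (θ c) (θ b) with h2 | h2 | h2
    · exact h0 ⟨h1, h2⟩
    · rw [hθ.injOn c hc b hb h2, orient_apex_self] at hcb
      linarith
    · have h3 : θ b + Real.pi < θ c := by
        by_contra h3
        have := hθ.orient_pos b hb c hc h2
          ((not_lt.1 h3).lt_of_ne (hθ.ne_add_pi b hb c hc))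
        linarith
      have := hθ.orient_pos' a ha c hc (by linarith)
      linarith

/-- The gap that contains the cut of the angle function: it runs from the last point back to the
first. -/
theorem isGap_of_none_outside (hθ : IsAngularOrder S o θ) (ho : o ∉ S) {A : Finset Plane}
    (hAS : A ⊆ S) (hoA : o ∈ interior (convexHull ℝ (A : Set Plane))) {a b : Plane} (ha : a ∈ S)
    (hb : b ∈ S) (haA : a ∈ convexHull ℝ (A : Set Plane)) (hbA : b ∈ convexHull ℝ (A : Set Plane))
    (h : ∀ c ∈ S, c ∈ convexHull ℝ (A : Set Plane) → θ a ≤ θ c ∧ θ c ≤ θ b) :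
    IsGap S o A b a := by
  have hlt : θ a + Real.pi < θ b := by
    by_contra hc
    have hgt := (not_lt.1 hc).lt_of_ne (hθ.ne_add_pi a ha b hb)
    obtain ⟨x, hxS, hxA, hx⟩ := exists_orient_neg_of_polygon A hAS hoA (b := a)
      (fun h => ho (h ▸ ha))
    obtain ⟨h1, h2⟩ := h x hxS hxA
    rcases h1.eq_or_lt with h1 | h1
    · rw [← hθ.injOn a ha x hxS h1, orient_apex_self] at hx
      exact lt_irrefl _ hx
    · exact hx.not_gt (hθ.orient_pos a ha x hxS h1 (by linarith))
  refine ⟨hbA, haA, hθ.orient_pos' a ha b hb hlt, ?_⟩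
  intro c hc hcA hbc hca
  obtain ⟨h1, h2⟩ := h c hc hcA
  rw [orient_antisymm] at hbc hca
  rcases h1.eq_or_lt with h1 | h1
  · rw [← hθ.injOn a ha c hc h1, orient_apex_self] at hca
    linarith
  rcases h2.eq_or_lt with h2 | h2
  · rw [hθ.injOn c hc b hb h2, orient_apex_self] at hbc
    linarith
  have h3 : θ a + Real.pi < θ c := by
    by_contra h3
    have := hθ.orient_pos a ha c hc h1 ((not_lt.1 h3).lt_of_ne (hθ.ne_add_pi a ha c hc))
    linarith
  have h4 : θ c + Real.pi < θ b := by
    by_contra h4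
    have := hθ.orient_pos c hc b hb h2 ((not_lt.1 h4).lt_of_ne (hθ.ne_add_pi c hc b hb))
    linarith
  linarith [hθ.lt_add_two_pi a ha b hb]

/-- Each of the two gaps may or may not pass the cut of the angle function. The four cases are
cyclic rotations of the configuration in `not_crossing_gaps`, with `A` and `B` exchanged when
exactly one gap passes the cut. -/
theorem not_crossing_gaps_angular {G : SimpleGraph Plane} (hθ : IsAngularOrder S o θ)
    (hS : NoThreeCollinear S) (hG : IsPlaneStraightLineGraph S G)
    (hgen : ∀ a ∈ S, ∀ b ∈ S, a ≠ b → orient o a b ≠ 0) {A B : Finset Plane}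
    (hA : A ∈ polygonsAround S G o) (hB : B ∈ polygonsAround S G o) {a b c d : Plane}
    (ha : a ∈ S) (hb : b ∈ S) (hc : c ∈ S) (hd : d ∈ S) (hac : θ a < θ c) (hcb : θ c < θ b)
    (hbd : θ b < θ d) (hgA : IsGap S o A a b ∨ IsGap S o A b a)
    (hgB : IsGap S o B c d ∨ IsGap S o B d c) : False := by
  obtain ⟨hA, hoA⟩ := mem_polygonsAround.1 hA
  obtain ⟨hB, hoB⟩ := mem_polygonsAround.1 hB
  obtain ⟨hAS, -, -, hAG⟩ := mem_convexPolygons.1 hA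
  obtain ⟨hBS, -, -, hBG⟩ := mem_convexPolygons.1 hB
  have short : ∀ x ∈ S, ∀ y ∈ S, 0 < orient o x y → θ y < θ x + Real.pi := by
    intro x hx y hy hpos
    by_contra h
    have := hθ.orient_pos' x hx y hy ((not_lt.1 h).lt_of_ne (hθ.ne_add_pi x hx y hy).symm)
    rw [orient_antisymm] at this
    linarith
  have long : ∀ x ∈ S, ∀ y ∈ S, θ x < θ y → 0 < orient o y x → θ x + Real.pi < θ y := by
    intro x hx y hy hlt hpos
    by_contra h
    have := hθ.orient_pos x hx y hy hlt ((not_lt.1 h).lt_of_ne (hθ.ne_add_pi x hx y hy))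
    rw [orient_antisymm] at this
    linarith
  rcases hgA with ⟨haA, hbA, h1, gA⟩ | ⟨hbA, haA, h1, gA⟩ <;>
    rcases hgB with ⟨hcB, hdB, h2, gB⟩ | ⟨hdB, hcB, h2, gB⟩
  · have h3 := short a ha b hb h1
    have h4 := short c hc d hd h2
    exact not_crossing_gaps hS hG hAS hBS hAG hBG hgen hoA hoB hb hc hbA hcB gA gB h1 h2
      (hθ.orient_pos a ha c hc hac (by linarith)) (hθ.orient_pos c hc b hb hcb (by linarith))
      (hθ.orient_pos b hb d hd hbd (by linarith))
  · have h3 := short a ha b hb h1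
    have h4 := long c hc d hd (by linarith) h2
    exact not_crossing_gaps hS hG hBS hAS hBG hAG hgen hoB hoA hc ha hcB haA gB gA h2 h1
      (hθ.orient_pos' a ha d hd (by linarith)) (hθ.orient_pos a ha c hc hac (by linarith))
      (hθ.orient_pos c hc b hb hcb (by linarith))
  · have h3 := long a ha b hb (by linarith) h1
    have h4 := short c hc d hd h2
    exact not_crossing_gaps hS hG hBS hAS hBG hAG hgen hoB hoA hd hb hdB hbA gB gA h2 h1
      (hθ.orient_pos c hc b hb hcb (by linarith)) (hθ.orient_pos b hb d hd hbd (by linarith))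
      (hθ.orient_pos' a ha d hd (by linarith))
  · have h3 := long a ha b hb (by linarith) h1
    have h4 := long c hc d hd (by linarith) h2
    have h5 := hθ.lt_add_two_pi a ha d hd
    exact not_crossing_gaps hS hG hAS hBS hAG hBG hgen hoA hoB ha hd haA hdB gA gB h1 h2
      (hθ.orient_pos b hb d hd hbd (by linarith)) (hθ.orient_pos' a ha d hd (by linarith))
      (hθ.orient_pos a ha c hc hac (by linarith))

end

/-! ### Transfer of the polygons around a point to the parabola. -/

open Classical in
/-- The chords between the ranks of consecutive points of the convex polygons around `o`. -/
noncomputable def gapChords (S : Finset Plane) (G : SimpleGraph Plane) (o : Plane)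
    (φ : Plane → ℕ) : Finset (ℕ × ℕ) :=
  {e ∈ Finset.range S.card ×ˢ Finset.range S.card | e.1 < e.2 ∧
    ∃ a ∈ S, ∃ b ∈ S, φ a = e.1 ∧ φ b = e.2 ∧
      ∃ A ∈ polygonsAround S G o, IsGap S o A a b ∨ IsGap S o A b a}

theorem isNoncrossing_gapChords {S : Finset Plane} {G : SimpleGraph Plane} {o : Plane}
    {θ : Plane → ℝ} {φ : Plane → ℕ} (hθ : IsAngularOrder S o θ)
    (hφ : ∀ x ∈ S, ∀ y ∈ S, φ x < φ y ↔ θ x < θ y)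
    (hS : NoThreeCollinear S) (hG : IsPlaneStraightLineGraph S G)
    (hgen : ∀ a ∈ S, ∀ b ∈ S, a ≠ b → orient o a b ≠ 0) :
    IsNoncrossing S.card (gapChords S G o φ) := by
  have key : ∀ e ∈ gapChords S G o φ, ∀ f ∈ gapChords S G o φ,
      ¬ (e.1 < f.1 ∧ f.1 < e.2 ∧ e.2 < f.2) := by
    rintro ⟨i, j⟩ he ⟨k, l⟩ hf ⟨h1, h2, h3⟩
    simp only [gapChords, Finset.mem_filter] at he hf h1 h2 h3
    obtain ⟨-, -, a, ha, b, hb, rfl, rfl, A, hA, hgA⟩ := he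
    obtain ⟨-, -, c, hc, d, hd, rfl, rfl, B, hB, hgB⟩ := hf
    exact not_crossing_gaps_angular hθ hS hG hgen hA hB ha hb hc hd ((hφ a ha c hc).1 h1)
      ((hφ c hc b hb).1 h2) ((hφ b hb d hd).1 h3) hgA hgB
  refine ⟨fun e he => ?_, fun e he => ?_, fun e he f hf => ?_⟩
  · simp only [gapChords, Finset.mem_filter] at he
    exact he.2.1
  · simp only [gapChords, Finset.mem_filter, Finset.mem_product, Finset.mem_range] at he
    exact he.1.2
  · rintro (h | h)
    · exact key e he f hf h
    · exact key f hf e he h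

/-- The number of convex polygons around a generic point is at most the number of convex polygons
in a suitable triangulation of points on the parabola. -/
theorem exists_card_polygonsAround_le {S : Finset Plane} {G : SimpleGraph Plane}
    (hS : NoThreeCollinear S) (hG : IsPlaneStraightLineGraph S G) {o : Plane} (ho : o ∉ S)
    (hgen : ∀ a ∈ S, ∀ b ∈ S, a ≠ b → orient o a b ≠ 0) :
    ∃ E, IsMaximalNoncrossing S.card E ∧ (polygonsAround S G o).card ≤
      (convexPolygons (parabolaPoints S.card) (chordGraph E)).card := by
  classical
  obtain ⟨θ, hθ⟩ := exists_isAngularOrder ho hgen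
  obtain ⟨φ, hφ, hφθ⟩ := exists_rank S θ
  have hφle : ∀ x ∈ S, ∀ y ∈ S, φ x ≤ φ y → θ x ≤ θ y := fun x hx y hy h => by
    by_contra hc
    exact absurd ((hφθ y hy x hx).2 (not_le.1 hc)) (not_lt_of_ge h)
  have hφinj : ∀ x ∈ S, ∀ y ∈ S, φ x = φ y → x = y := fun x hx y hy h =>
    hθ.injOn x hx y hy (le_antisymm (hφle x hx y hy h.le) (hφle y hy x hx h.ge))
  obtain ⟨E, hsub, hE⟩ := (isNoncrossing_gapChords (φ := φ) hθ hφθ hS hG hgen).exists_maximal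
  refine ⟨E, hE, ?_⟩
  -- All points of `S` in the hull are kept, not only the vertices: then a point of `S` strictly
  -- inside a gap of `A` is outside the hull of `A`, as `not_crossing_gaps` needs.
  set hat : Finset Plane → Finset Plane := fun A =>
    S.filter fun x => x ∈ convexHull ℝ (A : Set Plane) with hhat
  have mem_hat : ∀ A x, x ∈ hat A ↔ x ∈ S ∧ x ∈ convexHull ℝ (A : Set Plane) := by
    intro A x
    simp [hhat]
  have hinjS : Set.InjOn (fun x => parabolaPoint (φ x)) S := fun x hx y hy h =>
    hφinj x hx y hy (parabolaPoint_injective h)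
  apply Finset.card_le_card_of_injOn fun A => (hat A).image fun x => parabolaPoint (φ x)
  · intro A hA
    obtain ⟨hAp, hoA⟩ := mem_polygonsAround.1 hA
    obtain ⟨hAS, hA3, -, hAG⟩ := mem_convexPolygons.1 hAp
    have hsubset : (hat A).image (fun x => parabolaPoint (φ x)) ⊆ parabolaPoints S.card := by
      intro y hy
      obtain ⟨x, hx, rfl⟩ := Finset.mem_image.1 hy
      exact parabolaPoint_mem (hφ x ((mem_hat A x).1 hx).1)
    refine mem_convexPolygons.2 ⟨hsubset, ?_, inConvexPosition_of_subset_parabolaPoints hsubset, ?_⟩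
    · rw [Finset.card_image_of_injOn (hinjS.mono fun x hx => ((mem_hat A x).1 hx).1)]
      refine hA3.trans (Finset.card_le_card fun x hx => (mem_hat A x).2 ⟨hAS hx, ?_⟩)
      exact subset_convexHull ℝ _ hx
    · -- the boundary edges of the image polygon are gap chords
      have hlt : ∀ a b, a ∈ hat A → b ∈ hat A → φ a < φ b →
          (boundaryCycle ((hat A).image fun x => parabolaPoint (φ x))).Adj
            (parabolaPoint (φ a)) (parabolaPoint (φ b)) →
          (chordGraph E).Adj (parabolaPoint (φ a)) (parabolaPoint (φ b)) := by
        intro a b ha hb hab hadj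
        apply chordGraph_adj hab
        apply hsub
        have ha' := (mem_hat A a).1 ha
        have hb' := (mem_hat A b).1 hb
        have himg : ∀ x ∈ S, x ∈ convexHull ℝ (A : Set Plane) →
            parabolaPoint (φ x) ∈ (hat A).image fun x => parabolaPoint (φ x) :=
          fun x hx hxA => Finset.mem_image_of_mem _ ((mem_hat A x).2 ⟨hx, hxA⟩)
        simp only [gapChords, Finset.mem_filter, Finset.mem_product, Finset.mem_range]
        refine ⟨⟨hφ a ha'.1, hφ b hb'.1⟩, hab, a, ha'.1, b, hb'.1, rfl, rfl, A, hA, ?_⟩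
        -- A boundary chord of the image cannot have image points on both sides, so either no point
        -- is between `a` and `b` or none is outside.
        by_cases hbetween : ∃ c ∈ S, c ∈ convexHull ℝ (A : Set Plane) ∧ θ a < θ c ∧ θ c < θ b
        · right
          obtain ⟨c, hc, hcA, h1, h2⟩ := hbetween
          refine isGap_of_none_outside hθ ho hAS hoA ha'.1 hb'.1 ha'.2 hb'.2 ?_
          intro d hd hdA
          by_contra hcon
          refine not_crossing_of_boundaryCycle_adj ((hφθ a ha'.1 c hc).2 h1)
            ((hφθ c hc b hb'.1).2 h2) (l := φ d) ?_ (himg c hc hcA) (himg d hd hdA) hadj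
          rw [hφθ d hd a ha'.1, hφθ b hb'.1 d hd]
          by_contra! hcc
          exact hcon hcc
        · left
          exact isGap_of_none_between hθ ho hAS hoA ha'.1 hb'.1 ha'.2 hb'.2
            ((hφθ a ha'.1 b hb'.1).1 hab) fun c hc hcA h => hbetween ⟨c, hc, hcA, h⟩
      intro x y hxy
      obtain ⟨a, ha, rfl⟩ := Finset.mem_image.1 hxy.2.1
      obtain ⟨b, hb, rfl⟩ := Finset.mem_image.1 hxy.2.2.1
      rcases lt_trichotomy (φ a) (φ b) with h | h | h
      · exact hlt a b ha hb h hxy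
      · exact absurd (by rw [h]) hxy.1
      · exact (hlt b a hb ha h hxy.symm).symm
  · intro A hA B hB hAB
    obtain ⟨hA, -⟩ := mem_polygonsAround.1 hA
    obtain ⟨hB, -⟩ := mem_polygonsAround.1 hB
    obtain ⟨hAS, -, hAc, -⟩ := mem_convexPolygons.1 hA
    obtain ⟨hBS, -, hBc, -⟩ := mem_convexPolygons.1 hB
    have hle : ∀ A B : Finset Plane, A ⊆ S →
        (hat A).image (fun x => parabolaPoint (φ x)) = (hat B).image (fun x => parabolaPoint (φ x)) →
        convexHull ℝ (A : Set Plane) ⊆ convexHull ℝ (B : Set Plane) := by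
      intro A B hAS h
      apply convexHull_min _ (convex_convexHull ℝ _)
      intro x hx
      have hxi : parabolaPoint (φ x) ∈ (hat B).image fun x => parabolaPoint (φ x) := by
        rw [← h]
        exact Finset.mem_image_of_mem _ ((mem_hat A x).2 ⟨hAS hx, subset_convexHull ℝ _ hx⟩)
      obtain ⟨y, hy, hyx⟩ := Finset.mem_image.1 hxi
      obtain ⟨hyS, hyB⟩ := (mem_hat B y).1 hy
      rwa [← hinjS hyS (hAS hx) hyx]
    have hull := Set.Subset.antisymm (hle A B hAS hAB) (hle B A hBS hAB.symm)
    exact Finset.Subset.antisymm (subset_of_convexHull_eq hAc hull)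
      (subset_of_convexHull_eq hBc hull.symm)

/-! ### Sweeping the plane and splitting the polygons into classes. -/

open Filter Topology in
theorem eventually_injOn_add_mul {S : Finset Plane} {g h : Plane → ℝ}
    (hgh : ∀ a ∈ S, ∀ b ∈ S, g a = g b → h a = h b → a = b) :
    ∀ᶠ ε in 𝓝[>] (0 : ℝ), ∀ a ∈ S, ∀ b ∈ S, g a + ε * h a = g b + ε * h b → a = b := by
  rw [eventually_all_finset]
  intro a ha
  rw [eventually_all_finset]
  intro b hb
  by_cases hg : g a = g b
  · filter_upwards [self_mem_nhdsWithin] with ε hε h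
    rw [hg, add_right_inj] at h
    exact hgh a ha b hb hg (mul_left_cancel₀ (ne_of_gt hε) h)
  · have hc : ContinuousAt (fun ε : ℝ => g a + ε * h a - (g b + ε * h b)) 0 := by fun_prop
    have hne := (hc.eventually_ne (y := 0) (by simpa [sub_eq_zero] using hg)).filter_mono
      (nhdsWithin_le_nhds (s := Set.Ioi 0))
    filter_upwards [hne] with ε hε h
    exact absurd (sub_eq_zero.2 h) hε

open Filter Topology in
/-- A linear functional that is injective on `S` and whose two smallest values on `S` are taken
at the endpoints `u`, `w` of an edge of the convex hull. -/
theorem exists_sweep_functional {S : Finset Plane} (hS : NoThreeCollinear S) (hcard : 2 ≤ S.card) :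
    ∃ α β : ℝ, ∃ u ∈ S, ∃ w ∈ S,
      (∀ a ∈ S, ∀ b ∈ S, α * a 0 + β * a 1 = α * b 0 + β * b 1 → a = b) ∧
      α * u 0 + β * u 1 < α * w 0 + β * w 1 ∧
      ∀ x ∈ S, x ≠ u → x ≠ w → α * w 0 + β * w 1 < α * x 0 + β * x 1 ∧ 0 < orient u w x := by
  classical
  obtain ⟨δ, hδ⟩ := (eventually_injOn_add_mul (S := S) (g := fun x => x 0) (h := fun x => x 1)
    fun a _ b _ h0 h1 => by
      ext i
      fin_cases i
      · exact h0
      · exact h1).exists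
  have hne : S.Nonempty := Finset.card_pos.1 (by omega)
  obtain ⟨u, hu, humin⟩ := S.exists_min_image (fun x => x 0 + δ * x 1) hne
  have hlt : ∀ x ∈ S, x ≠ u → 0 < (x 0 + δ * x 1) - (u 0 + δ * u 1) := fun x hx hxu =>
    sub_pos.2 ((humin x hx).lt_of_ne fun h => hxu (hδ x hx u hu h.symm))
  have hne' : (S.erase u).Nonempty := Finset.card_pos.1 (by
    rw [Finset.card_erase_of_mem hu]; omega)
  obtain ⟨w, hw, hwmin⟩ := (S.erase u).exists_min_image
    (fun x => (x 1 - u 1) / ((x 0 + δ * x 1) - (u 0 + δ * u 1))) hne'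
  obtain ⟨hwu, hwS⟩ := Finset.mem_erase.1 hw
  have hpos : ∀ x ∈ S, x ≠ u → x ≠ w → 0 < orient u w x := by
    intro x hx hxu hxw
    refine lt_of_le_of_ne ?_ (hS.orient_ne_zero hu hwS hx hwu.symm hxu.symm hxw.symm).symm
    have h1 := hwmin x (Finset.mem_erase.2 ⟨hxu, hx⟩)
    rw [div_le_div_iff₀ (hlt w hwS hwu) (hlt x hx hxu)] at h1
    unfold orient
    linarith
  have hinj := eventually_injOn_add_mul (S := S) (g := orient u w) (h := fun x => x 0 + δ * x 1)
    fun a ha b hb _ h => hδ a ha b hb h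
  have hlow : ∀ᶠ ε in 𝓝[>] (0 : ℝ), ∀ x ∈ (S.erase u).erase w,
      0 < orient u w x + ε * ((x 0 + δ * x 1) - (w 0 + δ * w 1)) := by
    rw [eventually_all_finset]
    intro x hx
    simp only [Finset.mem_erase] at hx
    have hc : ContinuousAt (fun ε : ℝ =>
      orient u w x + ε * ((x 0 + δ * x 1) - (w 0 + δ * w 1))) 0 := by fun_prop
    exact (hc.eventually_const_lt (by simpa using hpos x hx.2.2 hx.2.1 hx.1)).filter_mono
      nhdsWithin_le_nhds
  obtain ⟨ε, ⟨hinj, hlow⟩, hε⟩ := ((hinj.and hlow).and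
    (self_mem_nhdsWithin : Set.Ioi (0 : ℝ) ∈ 𝓝[>] (0 : ℝ))).exists
  have hε : 0 < ε := hε
  refine ⟨u 1 - w 1 + ε, w 0 - u 0 + ε * δ, u, hu, w, hwS, ?_, ?_, ?_⟩
  · intro a ha b hb h
    apply hinj a ha b hb
    rw [orient_eq_affine, orient_eq_affine]
    linarith
  · have := mul_pos hε (hlt w hwS hwu)
    linarith
  · intro x hx hxu hxw
    refine ⟨?_, hpos x hx hxu hxw⟩
    have := hlow x (by simp [hx, hxu, hxw])
    rw [orient_eq_affine] at this
    linarith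

open Filter Topology in
/-- The level line through the middle vertex of a triangle enters the interior. -/
theorem eventually_mem_interior {A : Set Plane} {α β : ℝ} {a b c : Plane} (ha : a ∈ A)
    (hb : b ∈ A) (hc : c ∈ A) (hab : α * a 0 + β * a 1 < α * b 0 + β * b 1)
    (hbc : α * b 0 + β * b 1 < α * c 0 + β * c 1) (h : 0 < orient a b c) :
    ∀ᶠ ε in 𝓝[>] (0 : ℝ), b + ε • (!₂[-β, α] : Plane) ∈ interior (convexHull ℝ A) := by
  have hcont : Continuous fun ε : ℝ => orient c a (b + ε • (!₂[-β, α] : Plane)) := by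
    unfold orient
    fun_prop
  have h0 : 0 < orient c a (b + (0 : ℝ) • (!₂[-β, α] : Plane)) := by
    simpa [orient_rotate] using h
  have hev := ((hcont.tendsto 0).eventually_const_lt h0).filter_mono
    (nhdsWithin_le_nhds (s := Set.Ioi 0))
  filter_upwards [hev, self_mem_nhdsWithin] with ε h3 hε
  have hε : 0 < ε := hε
  have hsub : ({a, b, c} : Set Plane) ⊆ A := by
    rintro x (rfl | rfl | rfl) <;> assumption
  refine interior_mono (convexHull_mono hsub) ((mem_interior_triangle h).2 ⟨?_, ?_, h3⟩)
  · have := mul_pos hε (sub_pos.2 hab)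
    simp [orient]
    linarith
  · have := mul_pos hε (sub_pos.2 hbc)
    simp [orient]
    linarith

theorem exists_mem_open_orient_ne_zero (P : Finset (Plane × Plane)) :
    (∀ e ∈ P, e.1 ≠ e.2) → ∀ W : Set Plane, IsOpen W → W.Nonempty →
      ∃ o ∈ W, ∀ e ∈ P, orient e.1 e.2 o ≠ 0 := by
  classical
  induction P using Finset.induction_on with
  | empty => exact fun _ W _ ⟨o, ho⟩ => ⟨o, ho, by simp⟩
  | insert e P _ ih =>
    intro hP W hW hne
    have hopen : IsOpen {x | orient e.1 e.2 x ≠ 0} := by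
      apply isOpen_ne_fun _ continuous_const
      unfold orient
      fun_prop
    have hne' : (W ∩ {x | orient e.1 e.2 x ≠ 0}).Nonempty := by
      by_contra h
      have h0 : ∀ x ∈ W, orient e.1 e.2 x = 0 := fun x hx => by
        by_contra hx0
        exact h ⟨x, hx, hx0⟩
      obtain ⟨x, hx⟩ := hne
      have := orient_pos_of_mem_interior (hP e (Finset.mem_insert_self _ _))
        (fun y hy => (h0 y hy).ge) (hW.interior_eq.symm ▸ hx)
      exact this.ne' (h0 x hx)
    obtain ⟨o, ⟨hoW, hoe⟩, ho⟩ :=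
      ih (fun f hf => hP f (Finset.mem_insert_of_mem hf)) _ (hW.inter hopen) hne'
    refine ⟨o, hoW, fun f hf => ?_⟩
    rcases Finset.mem_insert.1 hf with rfl | hf
    · exact hoe
    · exact ho f hf

/-- An open set contains a point on none of the lines through two points of `S`. -/
theorem exists_generic_point (S : Finset Plane) {W : Set Plane} (hW : IsOpen W)
    (hne : W.Nonempty) : ∃ o ∈ W, ∀ a ∈ S, ∀ b ∈ S, a ≠ b → orient o a b ≠ 0 := by
  classical
  obtain ⟨o, hoW, ho⟩ := exists_mem_open_orient_ne_zero
    ((S ×ˢ S).filter fun e => e.1 ≠ e.2) (by simp) W hW hne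
  refine ⟨o, hoW, fun a ha b hb hab => ?_⟩
  rw [← orient_rotate]
  exact ho (a, b) (by simp [ha, hb, hab])

theorem exists_three_increasing {A : Finset Plane} {f : Plane → ℝ} (hA : 3 ≤ A.card)
    (hf : ∀ a ∈ A, ∀ b ∈ A, f a = f b → a = b) :
    ∃ a ∈ A, ∃ b ∈ A, ∃ c ∈ A, f a < f b ∧ f b < f c := by
  classical
  have hne : A.Nonempty := Finset.card_pos.1 (by omega)
  obtain ⟨a, ha, hamin⟩ := A.exists_min_image f hne
  obtain ⟨c, hc, hcmax⟩ := A.exists_max_image f hne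
  have hlt : 0 < ((A.erase a).erase c).card := by
    have h1 := Finset.card_erase_of_mem ha
    have h2 := Finset.pred_card_le_card_erase (s := A.erase a) (a := c)
    omega
  obtain ⟨b, hb⟩ := Finset.card_pos.1 hlt
  simp only [Finset.mem_erase] at hb
  obtain ⟨hbc, hba, hb⟩ := hb
  exact ⟨a, ha, b, hb, c, hc, (hamin b hb).lt_of_ne fun h => hba (hf a ha b hb h).symm,
    (hcmax b hb).lt_of_ne fun h => hbc (hf b hb c hc h)⟩

open Filter Topology in
/-- The convex polygons of a plane graph fall into at most `2 * n - 5` classes with a common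
generic interior point each. -/
theorem card_convexPolygons_le {S : Finset Plane} {G : SimpleGraph Plane}
    (hS : NoThreeCollinear S) (hn : 3 ≤ S.card) {M : ℕ}
    (hM : ∀ o ∉ S, (∀ a ∈ S, ∀ b ∈ S, a ≠ b → orient o a b ≠ 0) →
      (polygonsAround S G o).card ≤ M) :
    (convexPolygons S G).card ≤ (2 * S.card - 5) * M := by
  classical
  obtain ⟨α, β, u, hu, w, hw, hinj, huw, hrest⟩ := exists_sweep_functional hS (by omega)
  set f : Plane → ℝ := fun x => α * x 0 + β * x 1 with hf
  obtain ⟨m, hm, hmax⟩ := S.exists_max_image f ⟨u, hu⟩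
  obtain ⟨x, hx⟩ : ((S.erase u).erase w).Nonempty := by
    apply Finset.card_pos.1
    have h1 := Finset.card_erase_of_mem hu
    have h2 := Finset.pred_card_le_card_erase (s := S.erase u) (a := w)
    omega
  simp only [Finset.mem_erase] at hx
  have hwx : f w < f x := (hrest x hx.2.2 hx.2.1 hx.1).1
  have hwm : f w < f m := hwx.trans_le (hmax x hx.2.2)
  have humin : ∀ y ∈ S, f u ≤ f y := by
    intro y hy
    by_cases hyu : y = u
    · rw [hyu]
    by_cases hyw : y = w
    · rw [hyw]; exact huw.le
    exact huw.le.trans (hrest y hy hyu hyw).1.le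
  have hne_of_lt : ∀ {y z : Plane}, f y < f z → y ≠ z := fun h e => h.ne (congrArg f e)
  set V := (S.erase u).erase m with hV
  set C : Finset (Plane × Bool) := (V ×ˢ Finset.univ).erase (w, false) with hC
  have hwV : w ∈ V := by
    simp only [hV, Finset.mem_erase]
    exact ⟨hne_of_lt hwm, (hne_of_lt huw).symm, hw⟩
  have hcardC : C.card = 2 * S.card - 5 := by
    have hmu : m ∈ S.erase u :=
      Finset.mem_erase.2 ⟨(hne_of_lt (huw.trans hwm)).symm, hm⟩
    rw [hC, Finset.card_erase_of_mem (by simp [hwV]), Finset.card_product, hV,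
      Finset.card_erase_of_mem hmu, Finset.card_erase_of_mem hu]
    simp
    omega
  set dir : Bool → Plane := fun s => if s then !₂[-β, α] else !₂[β, -α] with hdir
  set good : Plane × Bool → Finset (Finset Plane) := fun e => (convexPolygons S G).filter fun A =>
    ∀ᶠ ε in 𝓝[>] (0 : ℝ), e.1 + ε • dir e.2 ∈ interior (convexHull ℝ (A : Set Plane)) with hgood
  have hclass : ∀ A ∈ convexPolygons S G, ∃ e ∈ C, A ∈ good e := by
    intro A hA
    obtain ⟨hAS, hA3, -, -⟩ := mem_convexPolygons.1 hA
    obtain ⟨a, ha, b, hb, c, hc, hab, hbc⟩ := exists_three_increasing (f := f) hA3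
      fun a ha b hb => hinj a (hAS ha) b (hAS hb)
    have hbV : b ∈ V := by
      simp only [hV, Finset.mem_erase]
      refine ⟨?_, ?_, hAS hb⟩
      · rintro rfl
        exact hbc.not_ge (hmax c (hAS hc))
      · rintro rfl
        exact hab.not_ge (humin a (hAS ha))
    have hne := hS.orient_ne_zero (hAS ha) (hAS hb) (hAS hc) (hne_of_lt hab)
      (hne_of_lt (hab.trans hbc)) (hne_of_lt hbc)
    rcases hne.lt_or_gt with h | h
    · refine ⟨(b, false), ?_, Finset.mem_filter.2 ⟨hA, ?_⟩⟩
      · simp only [hC, Finset.mem_erase, Finset.mem_product, Finset.mem_univ, and_true]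
        refine ⟨?_, hbV⟩
        intro hbw
        obtain rfl : b = w := congrArg Prod.fst hbw
        have hau : a = u := by
          by_contra hau
          exact hab.not_gt (hrest a (hAS ha) hau (hne_of_lt hab)).1
        subst hau
        have := (hrest c (hAS hc) (hne_of_lt (hab.trans hbc)).symm (hne_of_lt hbc).symm).2
        linarith
      · have := eventually_mem_interior (A := (A : Set Plane)) (α := -α) (β := -β) hc hb ha
          (by simp only [hf] at hbc; linarith) (by simp only [hf] at hab; linarith)
          (by unfold orient at h ⊢; linarith)
        simpa [hdir] using this
    · refine ⟨(b, true), ?_, Finset.mem_filter.2 ⟨hA, ?_⟩⟩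
      · simp [hC, hbV]
      · simpa [hdir] using eventually_mem_interior (A := (A : Set Plane)) ha hb hc hab hbc h
  have hpoint : ∀ e : Plane × Bool, ∃ o, (∀ a ∈ S, ∀ b ∈ S, a ≠ b → orient o a b ≠ 0) ∧
      ∀ A ∈ good e, o ∈ interior (convexHull ℝ (A : Set Plane)) := by
    intro e
    have hev : ∀ᶠ ε in 𝓝[>] (0 : ℝ), ∀ A ∈ good e,
        e.1 + ε • dir e.2 ∈ interior (convexHull ℝ (A : Set Plane)) :=
      (eventually_all_finset _).2 fun A hA => (Finset.mem_filter.1 hA).2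
    obtain ⟨ε, hε⟩ := hev.exists
    obtain ⟨o, hoW, ho⟩ := exists_generic_point S
      (W := ⋂ A ∈ good e, interior (convexHull ℝ (A : Set Plane)))
      (isOpen_biInter_finset fun A _ => isOpen_interior) ⟨_, Set.mem_iInter₂.2 hε⟩
    exact ⟨o, ho, Set.mem_iInter₂.1 hoW⟩
  choose o hgen ho using hpoint
  have hoS : ∀ e, o e ∉ S := by
    intro e he
    obtain ⟨y, hy, hye⟩ := S.exists_mem_ne (by omega) (o e)
    apply hgen e (o e) he y hy hye.symm
    unfold orient
    ring
  calc (convexPolygons S G).card ≤ (C.biUnion fun e => polygonsAround S G (o e)).card := by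
        apply Finset.card_le_card
        intro A hA
        obtain ⟨e, he, hAe⟩ := hclass A hA
        exact Finset.mem_biUnion.2 ⟨e, he, mem_polygonsAround.2 ⟨hA, ho e A hAe⟩⟩
    _ ≤ C.card * M := Finset.card_biUnion_le_card_mul _ _ _ fun e _ => hM _ (hoS e) (hgen e)
    _ = (2 * S.card - 5) * M := by rw [hcardC]

theorem card_convexPolygons_le_two_pow (S : Finset Plane) (G : SimpleGraph Plane) :
    (convexPolygons S G).card ≤ 2 ^ S.card := by
  rw [← Finset.card_powerset]
  exact Finset.card_le_card fun A hA => Finset.mem_powerset.2 (mem_convexPolygons.1 hA).1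

theorem convexPolygonCounts_subset (n : ℕ) : convexPolygonCounts n ⊆ polygonCounts n := by
  rintro m ⟨S, G, hS, -, hG, hm⟩
  exact ⟨S, G, hS, hG, hm⟩

theorem bddAbove_polygonCounts (n : ℕ) : BddAbove (polygonCounts n) := by
  refine ⟨2 ^ n, ?_⟩
  rintro m ⟨S, G, rfl, -, rfl⟩
  exact card_convexPolygons_le_two_pow S G

theorem IsMaximalNoncrossing.card_mem_convexPolygonCounts {n : ℕ} {E : Finset (ℕ × ℕ)}
    (h : IsMaximalNoncrossing n E) (hn : 3 ≤ n) :
    (convexPolygons (parabolaPoints n) (chordGraph E)).card ∈ convexPolygonCounts n :=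
  ⟨_, _, card_parabolaPoints n, inConvexPosition_of_subset_parabolaPoints subset_rfl,
    h.isTriangulation hn, rfl⟩

theorem convexPolygonCounts_nonempty {n : ℕ} (hn : 3 ≤ n) : (convexPolygonCounts n).Nonempty := by
  have h : IsNoncrossing n ∅ := ⟨by simp, by simp, by simp⟩
  obtain ⟨E, -, hE⟩ := h.exists_maximal
  exact ⟨_, hE.card_mem_convexPolygonCounts hn⟩

theorem theorem1 (n : ℕ) (hn : 3 ≤ n) :
    IsGreatest (polygonCounts n) (maxConvexPolygons n) ∧
    IsGreatest (convexPolygonCounts n) (maxConvexPolygonsConvexPosition n) ∧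
    maxConvexPolygons n ≤ (2 * n - 5) * maxConvexPolygonsConvexPosition n := by
  have hb := bddAbove_polygonCounts n
  have hb' := hb.mono (convexPolygonCounts_subset n)
  have hne' := convexPolygonCounts_nonempty hn
  have hne := hne'.mono (convexPolygonCounts_subset n)
  have hmem : maxConvexPolygons n ∈ polygonCounts n := Nat.sSup_mem hne hb
  refine ⟨⟨hmem, fun m hm => le_csSup hb hm⟩, ⟨Nat.sSup_mem hne' hb', fun m hm => le_csSup hb' hm⟩,
    ?_⟩
  obtain ⟨S, G, hS, hG, hm⟩ := hmem
  subst hS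
  rw [hm]
  refine card_convexPolygons_le hG.noThreeCollinear hn fun o ho hgen => ?_
  obtain ⟨E, hE, hle⟩ := exists_card_polygonsAround_le hG.noThreeCollinear hG.plane ho hgen
  exact hle.trans (le_csSup hb' (hE.card_mem_convexPolygonCounts hn))
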